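/- All normed spaces are real and need not be complete; $\dim E>2$ includes $\dim E=\infty$. A projection on $E$ is an idempotent linear map $E\to E$; it is nontrivial if it is neither $0$ nor the identity. For $1\le p<\infty$ put $t^{[p]}=t^p$ $(t\ge 0)$ and $a\oplus_p b=a+b$; for $p=\infty$ put $t^{[\infty]}=t$ and $a\oplus_\infty b=\max(a,b)$. For $p,q\in[1,\infty]$ put $d(p,q)=|p-q|$ if $p<\infty$ (so $d(p,\infty)=\infty$), and $d(\infty,q)=1/q$ (with $1/\infty=0$). **(1) Uniform version of Behrends' theorem.** Let $k\in\mathbb N$ and $p,q\in[1,\infty]$ with $p\ne 2$. For every integer $n\ge 1$ there is an integer $m\ge 1$, depending only on $k,p,q,n$, such that the following holds for every normed space $E$ with $\dim E>2$. Let $P,Q$ be projections on $E$ with $\|Px\|\le k\|x\|$ and $\|Qx\|\le k\|x\|$ for all $x$, and let $f^p,f^q:E\to\mathbb R$ have the following property for $u=p$ and $u=q$ respectively: $f^u$ has the same moduli of uniform continuity on balls and the same bounds on balls as $x\mapsto\|x\|^{[u]}$, and for all rationals $0\le s<r$ and all $x$ with $\|x\|\le r$, either $\|x\|\le s$ or $s^{[u]}\le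 f^u(x)\le r^{[u]}$ (that is, $f^u(x)=\|x\|^{[u]}$). Suppose that for all $x$ with $\|x\|\le 1-\frac1m$ $$f^p(x)-\tfrac1m\le f^p(Px)\oplus_p f^p(x-Px)\le f^p(x)+\tfrac1m,\qquad f^q(x)-\tfrac1m\le f^q(Qx)\oplus_q f^q(x-Qx)\le f^q(x)+\tfrac1m .$$ Then $\|PQx-QPx\|\le\frac1n$ whenever $\|x\|\le1-\frac1n$. If moreover $P$ and $Q$ are both nontrivial, then also $|f^p(x)-f^q(x)|\le\frac1n$ whenever $\|x\|\le1-\frac1n$, and $d(p,q)\le\frac1n$. **(2) Theorem of Cambern, Jarosz and Wodinski.** For every $p\in[1,\infty]$ with $p\neq2$ there is a function $\varepsilon'=\varepsilon'_p:(0,\infty)\to[0,\infty]$ with $\varepsilon'(\varepsilon)\to0$ as $\varepsilon\to0^+$ such that the following holds for all $\varepsilon>0$, all $q\in[1,\infty]$ and every normed space $E$ with $\dim E>2$. If $P,Q$ are projections on $E$ with $$(1-\varepsilon)\|x\|\le(\|Px\|^p+\|x-Px\|^p)^{1/p}\le(1+\varepsilon)\|x\|,\qquad (1-\varepsilon)\|x\|\le(\|Qx\|^q+\|x-Qx\|^q)^{1/q}\le(1+\varepsilon)\|x\|$$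 for all $x\in E$ (with the maximum of the two norms in the middle when the exponent is $\infty$), then $\|PQx-QPx\|\le\varepsilon'(\varepsilon)\|x\|$ for all $x\in E$, and if $P$ and $Q$ are both nontrivial, then $d(p,q)\le\varepsilon'(\varepsilon)$. -/

import Mathlib

open Filter Topology
open scoped ENNReal

universe u

noncomputable section

/-- The function `t ↦ t ^ p` on `[0, ∞)` for an exponent `p ∈ [1, ∞]`; for `p = ∞` no power is taken. -/
def lpPow (p : ℝ≥0∞) (t : ℝ) : ℝ :=
  if p = ∞ then t else t ^ p.toReal

/-- How `p`-th powers of norms are combined: the sum if `p < ∞`, the maximum if `p = ∞`. -/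
def lpCombine (p : ℝ≥0∞) (a b : ℝ) : ℝ :=
  if p = ∞ then max a b else a + b

/-- The `ℓ^p`-norm of a pair of nonnegative reals: `(a ^ p + b ^ p) ^ (1 / p)`, or `max a b`
if `p = ∞`. -/
def lpPairNorm (p : ℝ≥0∞) (a b : ℝ) : ℝ :=
  if p = ∞ then max a b else (a ^ p.toReal + b ^ p.toReal) ^ (1 / p.toReal)

/-- The distance of `q` from `p` in `[1, ∞]`. For `p < ∞` it is `|p - q|` (which is `∞` if `q = ∞`;
one of the two truncated differences vanishes); for `p = ∞` it is `1 / q` (which is `0` if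
`q = ∞`). -/
def exponentDist (p q : ℝ≥0∞) : ℝ≥0∞ :=
  if p = ∞ then q⁻¹ else (p - q) + (q - p)

section Normed

variable {E : Type u} [NormedAddCommGroup E] [NormedSpace ℝ E]

/-- A linear map is a projection if it is idempotent. -/
def IsProjection (P : E →ₗ[ℝ] E) : Prop :=
  ∀ x, P (P x) = P x

/-- A projection is nontrivial if it is neither zero nor the identity. -/
def IsNontrivialProjection (P : E →ₗ[ℝ] E) : Prop :=
  P ≠ 0 ∧ P ≠ LinearMap.id

/-- `f` is an interpretation of the symbol `f^p`: it has the same moduli of uniform continuity on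
balls and the same bounds as `‖·‖ ^ p`, and satisfies, for rational `0 ≤ s < r`, the sentence
`∀ x (‖x‖ ≤ r → (‖x‖ ≤ s ∨ s ^ p ≤ f x ≤ r ^ p))`. -/
structure IsPowerSymbol (p : ℝ≥0∞) (f : E → ℝ) : Prop where
  modulus : ∀ (N : ℕ) (ε δ : ℝ), 0 < ε → 0 < δ →
    (∀ x y : E, ‖x‖ < N → ‖y‖ < N → ‖x - y‖ < δ → |lpPow p ‖x‖ - lpPow p ‖y‖| < ε) →
    ∀ x y : E, ‖x‖ < N → ‖y‖ < N → ‖x - y‖ < δ → |f x - f y| < ε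
  bound : ∀ (N : ℕ) (x : E), ‖x‖ ≤ N → |f x| ≤ lpPow p N
  sandwich : ∀ s r : ℚ, 0 ≤ s → s < r → ∀ x : E, ‖x‖ ≤ r →
    ‖x‖ ≤ s ∨ (lpPow p s ≤ f x ∧ f x ≤ lpPow p r)

/-- `∀ x (‖x‖ ≤ 1 - 1/m → f x - 1/m ≤ f (P x) + f (x - P x) ≤ f x + 1/m)`, the `m`-th
approximation of the sentence saying that `P` is an `L^p`-projection
(with `max` in place of `+` if `p = ∞`). -/
def ApproxLpSentence (p : ℝ≥0∞) (f : E → ℝ) (P : E →ₗ[ℝ] E) (m : ℕ) : Prop :=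
  ∀ x : E, ‖x‖ ≤ 1 - 1 / (m : ℝ) →
    f x - 1 / (m : ℝ) ≤ lpCombine p (f (P x)) (f (x - P x)) ∧
    lpCombine p (f (P x)) (f (x - P x)) ≤ f x + 1 / (m : ℝ)

/-- `(1 - ε) ‖x‖ ≤ (‖P x‖ ^ p + ‖x - P x‖ ^ p) ^ (1 / p) ≤ (1 + ε) ‖x‖` for all `x`. -/
def IsAlmostLp (p : ℝ≥0∞) (P : E →ₗ[ℝ] E) (ε : ℝ) : Prop :=
  ∀ x : E, (1 - ε) * ‖x‖ ≤ lpPairNorm p ‖P x‖ ‖x - P x‖ ∧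
    lpPairNorm p ‖P x‖ ‖x - P x‖ ≤ (1 + ε) * ‖x‖

end Normed

/-- Normed space structures `(E, P, Q, f^p, f^q)`: two linear projections
of norm at most `k`, and interpretations of the symbols `f^p` and `f^q`. -/
structure ProjectionPairStructure (k : ℕ) (p q : ℝ≥0∞) (E : Type u)
    [NormedAddCommGroup E] [NormedSpace ℝ E] where
  P : E →ₗ[ℝ] E
  Q : E →ₗ[ℝ] E
  fp : E → ℝ
  fq : E → ℝ
  isProjection_P : IsProjection P
  isProjection_Q : IsProjection Q
  bound_P : ∀ x, ‖P x‖ ≤ k * ‖x‖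
  bound_Q : ∀ x, ‖Q x‖ ≤ k * ‖x‖
  isPowerSymbol_fp : IsPowerSymbol p fp
  isPowerSymbol_fq : IsPowerSymbol q fq

end

/-! ### The two-dimensional `ℓ^p`-norm -/

/-! Both parts follow by compactness from the exact theorem of Behrends (`IsLpProj.commute`,
`IsLpProj.exponent_eq`): in dimension greater than two an `L^p`- and an `L^q`-projection commute
unless `p = q = 2`, and if both are nontrivial then `p = q`.

For most exponents the exact theorem is a convexity argument in a plane. If `P x = x` but `Q x` is
not in the range of `P`, put `a = P Q x`, `c = x - P Q x` and `β = ‖Q x - P Q x‖`. Computing the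
norm of `s • Q x + t • (x - Q x)` through `P` and through `Q` shows that `‖s • a + t • c‖ ^ p` is
the `p`-th power of an `ℓ^q`-norm of `(s, t)` minus `(|s - t| β) ^ p`. This cannot be convex for the
exponents in `IsRigidPair`, so the range of `P`, and likewise its kernel, is invariant under `Q`.

The remaining pairs `(∞, ∞)` and `(1, ∞)` are treated in the dual ball. An extreme functional is
either fixed or killed by composition with an `L^∞`-projection, so two such projections commute. If
there is also a nontrivial `L^1`-projection, the dual ball is a product, which has so many extreme
points that the dimension is at most two (`IsLpProj.rank_le_two`). Once the projections commute, a
nonzero common range vector and a nonzero common kernel vector give `2 ^ (1/p) = 2 ^ (1/q)`.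

For the uniform statements, examples whose defects tend to zero but whose conclusions fail by a
fixed amount have an ultraproduct. Their exponents converge in the compact space `[1, ∞]`, and joint
continuity of `lpPairNorm` makes the limit projections exact; dimension, nontriviality and failure
of commutation survive in the limit. This gives `AlmostLpPair.exists_forall_hasDefect`. The second
part then uses the least admissible bound `defectBound`; the first is reduced to the same lemma by
`ApproxLpSentence.isAlmostLp`. -/

theorem lpPairNorm_top (a b : ℝ) : lpPairNorm ∞ a b = max a b := by
  simp [lpPairNorm]

theorem lpPairNorm_of_ne_top {p : ℝ≥0∞} (hp : p ≠ ∞) (a b : ℝ) :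
    lpPairNorm p a b = (a ^ p.toReal + b ^ p.toReal) ^ (1 / p.toReal) := by
  simp [lpPairNorm, hp]

theorem one_le_toReal {p : ℝ≥0∞} (hp : 1 ≤ p) (hp' : p ≠ ∞) : 1 ≤ p.toReal := by
  rw [← ENNReal.toReal_one]
  exact (ENNReal.toReal_le_toReal (by simp) hp').2 hp

theorem lpPairNorm_comm (p : ℝ≥0∞) (a b : ℝ) : lpPairNorm p a b = lpPairNorm p b a := by
  unfold lpPairNorm
  rw [max_comm, add_comm]

theorem lpPairNorm_nonneg (p : ℝ≥0∞) {a b : ℝ} (ha : 0 ≤ a) (hb : 0 ≤ b) :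
    0 ≤ lpPairNorm p a b := by
  unfold lpPairNorm
  split_ifs
  · exact le_max_of_le_left ha
  · positivity

theorem lpPairNorm_rpow {p : ℝ≥0∞} (hp1 : 1 ≤ p) (hp : p ≠ ∞) {a b : ℝ} (ha : 0 ≤ a)
    (hb : 0 ≤ b) : lpPairNorm p a b ^ p.toReal = a ^ p.toReal + b ^ p.toReal := by
  have := one_le_toReal hp1 hp
  rw [lpPairNorm_of_ne_top hp, one_div, Real.rpow_inv_rpow (by positivity) (by linarith)]

theorem lpPairNorm_mul {p : ℝ≥0∞} (hp1 : 1 ≤ p) {a b c : ℝ} (ha : 0 ≤ a) (hb : 0 ≤ b)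
    (hc : 0 ≤ c) : lpPairNorm p (c * a) (c * b) = c * lpPairNorm p a b := by
  by_cases hp : p = ∞
  · subst hp
    rw [lpPairNorm_top, lpPairNorm_top, mul_max_of_nonneg _ _ hc]
  · have := one_le_toReal hp1 hp
    rw [lpPairNorm_of_ne_top hp, lpPairNorm_of_ne_top hp, Real.mul_rpow hc ha, Real.mul_rpow hc hb,
      ← mul_add, Real.mul_rpow (by positivity) (by positivity), one_div,
      Real.rpow_rpow_inv hc (by linarith)]

theorem lpPairNorm_zero_right {p : ℝ≥0∞} (hp1 : 1 ≤ p) {a : ℝ} (ha : 0 ≤ a) :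
    lpPairNorm p a 0 = a := by
  by_cases hp : p = ∞
  · subst hp
    rw [lpPairNorm_top, max_eq_left ha]
  · have := one_le_toReal hp1 hp
    rw [lpPairNorm_of_ne_top hp, Real.zero_rpow (by linarith), add_zero, one_div,
      Real.rpow_rpow_inv ha (by linarith)]

theorem max_le_lpPairNorm {p : ℝ≥0∞} (hp1 : 1 ≤ p) {a b : ℝ} (ha : 0 ≤ a) (hb : 0 ≤ b) :
    max a b ≤ lpPairNorm p a b := by
  by_cases hp : p = ∞
  · subst hp
    rw [lpPairNorm_top]
  · have := one_le_toReal hp1 hp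
    rw [lpPairNorm_of_ne_top hp, one_div]
    have ha' := Real.rpow_nonneg ha p.toReal
    have hb' := Real.rpow_nonneg hb p.toReal
    refine max_le ?_ ?_
    · rw [Real.le_rpow_inv_iff_of_pos ha (by positivity) (by linarith)]
      linarith
    · rw [Real.le_rpow_inv_iff_of_pos hb (by positivity) (by linarith)]
      linarith

theorem lpPairNorm_le_mul_max {p : ℝ≥0∞} (hp1 : 1 ≤ p) {a b : ℝ} (ha : 0 ≤ a) (hb : 0 ≤ b) :
    lpPairNorm p a b ≤ 2 ^ (p⁻¹).toReal * max a b := by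
  by_cases hp : p = ∞
  · subst hp
    simp [lpPairNorm_top]
  · have := one_le_toReal hp1 hp
    have hm : 0 ≤ max a b := le_max_of_le_left ha
    rw [lpPairNorm_of_ne_top hp, one_div, ENNReal.toReal_inv,
      Real.rpow_inv_le_iff_of_pos (by positivity) (by positivity) (by linarith),
      Real.mul_rpow (by positivity) hm, Real.rpow_inv_rpow (by norm_num) (by linarith), two_mul]
    have h1 := Real.rpow_le_rpow ha (le_max_left a b) (by linarith : 0 ≤ p.toReal)
    have h2 := Real.rpow_le_rpow hb (le_max_right a b) (by linarith : 0 ≤ p.toReal)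
    linarith

theorem lpPairNorm_one_one (p : ℝ≥0∞) : lpPairNorm p 1 1 = 2 ^ (p⁻¹).toReal := by
  by_cases hp : p = ∞
  · subst hp
    simp [lpPairNorm_top]
  · rw [lpPairNorm_of_ne_top hp, ENNReal.toReal_inv, one_div, Real.one_rpow]
    norm_num

theorem eq_of_lpPairNorm_one_one_eq {p q : ℝ≥0∞} (hp : 1 ≤ p) (hq : 1 ≤ q)
    (h : lpPairNorm p 1 1 = lpPairNorm q 1 1) : p = q := by
  rw [lpPairNorm_one_one, lpPairNorm_one_one] at h
  have h1 := (Real.rpow_right_inj (by norm_num) (by norm_num)).1 h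
  have hp0 : p⁻¹ ≠ ∞ := by
    simpa using (zero_lt_one.trans_le hp).ne'
  have hq0 : q⁻¹ ≠ ∞ := by
    simpa using (zero_lt_one.trans_le hq).ne'
  exact inv_injective ((ENNReal.toReal_eq_toReal_iff' hp0 hq0).1 h1)

/-- Continuity jointly in the exponent is what lets `q` vary in the ultraproduct. At `q₀ = ∞` the
norm is squeezed between `max a b` and `2 ^ (1/q) * max a b`. -/
theorem tendsto_lpPairNorm {ι : Type*} {l : Filter ι} {q : ι → ℝ≥0∞} {a b : ι → ℝ} {q₀ : ℝ≥0∞}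
    {a₀ b₀ : ℝ} (hq1 : ∀ i, 1 ≤ q i) (hq₀ : 1 ≤ q₀) (ha0 : ∀ i, 0 ≤ a i) (hb0 : ∀ i, 0 ≤ b i)
    (hq : Tendsto q l (𝓝 q₀)) (ha : Tendsto a l (𝓝 a₀)) (hb : Tendsto b l (𝓝 b₀)) :
    Tendsto (fun i => lpPairNorm (q i) (a i) (b i)) l (𝓝 (lpPairNorm q₀ a₀ b₀)) := by
  by_cases h : q₀ = ∞
  · subst h
    rw [lpPairNorm_top]
    refine tendsto_of_tendsto_of_tendsto_of_le_of_le (ha.max hb) ?_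
      (fun i => max_le_lpPairNorm (hq1 i) (ha0 i) (hb0 i))
      (fun i => lpPairNorm_le_mul_max (hq1 i) (ha0 i) (hb0 i))
    have h1 : Tendsto (fun i => ((q i)⁻¹).toReal) l (𝓝 0) := by
      have := (ENNReal.tendsto_toReal (by simp : (∞ : ℝ≥0∞)⁻¹ ≠ ∞)).comp hq.inv
      rwa [ENNReal.inv_top, ENNReal.toReal_zero] at this
    have h2 : Tendsto (fun i => (2 : ℝ) ^ ((q i)⁻¹).toReal) l (𝓝 (2 ^ (0 : ℝ))) :=
      tendsto_const_nhds.rpow h1 (by norm_num)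
    simpa using h2.mul (ha.max hb)
  · have h1 := one_le_toReal hq₀ h
    have hr := (ENNReal.tendsto_toReal h).comp hq
    rw [lpPairNorm_of_ne_top h]
    have hmain := ((ha.rpow hr (Or.inr (by linarith))).add
      (hb.rpow hr (Or.inr (by linarith)))).rpow ((tendsto_const_nhds (x := (1 : ℝ))).div hr (by linarith))
      (Or.inr (by positivity))
    refine hmain.congr' ?_
    filter_upwards [hq.eventually_ne h] with i hi
    simp [lpPairNorm_of_ne_top hi]

/-! ### Elementary estimates for powers -/

theorem one_add_rpow_le {r u : ℝ} (hr : 0 ≤ r) (hu : -1 < u) (hru : |r * u| ≤ 1) :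
    (1 + u) ^ r ≤ 1 + r * u + (r * u) ^ 2 := by
  have h1 : (1 + u) ^ r ≤ Real.exp (r * u) := by
    rw [Real.rpow_def_of_pos (by linarith), mul_comm]
    refine Real.exp_le_exp.2 (mul_le_mul_of_nonneg_left ?_ hr)
    have := Real.log_le_sub_one_of_pos (by linarith : 0 < 1 + u)
    linarith
  have h2 := (abs_le.1 (Real.abs_exp_sub_one_sub_id_le hru)).2
  linarith

theorem norm_rpow_midpoint {E : Type*} [NormedAddCommGroup E] [NormedSpace ℝ E] {r : ℝ}
    (hr : 1 ≤ r) (u v : E) : 2 * ‖u‖ ^ r ≤ ‖u + v‖ ^ r + ‖u - v‖ ^ r := by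
  have h1 : ‖u‖ ≤ 1 / 2 * ‖u + v‖ + 1 / 2 * ‖u - v‖ := by
    have h := norm_add_le (u + v) (u - v)
    have h2 : (u + v) + (u - v) = (2 : ℝ) • u := by
      rw [two_smul]; abel
    rw [h2, norm_smul] at h
    norm_num at h
    linarith
  have h2 := Real.rpow_le_rpow (norm_nonneg u) h1 (by linarith : 0 ≤ r)
  have h3 := (convexOn_rpow hr).2 (norm_nonneg (u + v)) (norm_nonneg (u - v))
    (by norm_num : (0 : ℝ) ≤ 1 / 2) (by norm_num : (0 : ℝ) ≤ 1 / 2) (by norm_num)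
  simp only [smul_eq_mul] at h3
  linarith

theorem false_of_forall_rpow_le {p q c C δ : ℝ} (hpq : p < q) (hc : 0 < c) (hδ : 0 < δ)
    (h : ∀ s, 0 < s → s < δ → c * s ^ p ≤ C * s ^ q) : False := by
  have hlim : Tendsto (fun s : ℝ => C * s ^ (q - p)) (𝓝[>] 0) (𝓝 (C * 0)) := by
    refine Tendsto.const_mul _ ?_
    have := (Real.continuousAt_rpow_const 0 (q - p) (Or.inr (by linarith))).tendsto
    rw [Real.zero_rpow (by linarith)] at this
    exact this.mono_left nhdsWithin_le_nhds
  have hge : ∀ᶠ s in 𝓝[>] (0 : ℝ), c ≤ C * s ^ (q - p) := by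
    filter_upwards [Ioo_mem_nhdsGT hδ] with s hs
    have h1 := h s hs.1 hs.2
    have h2 : s ^ q = s ^ (q - p) * s ^ p := by
      rw [← Real.rpow_add hs.1]; ring_nf
    rw [h2, ← mul_assoc] at h1
    exact le_of_mul_le_mul_right h1 (Real.rpow_pos_of_pos hs.1 p)
  have := ge_of_tendsto hlim hge
  linarith

/-- A second-order upper Taylor bound, from two uses of `one_add_rpow_le`. Only the linear
coefficient must be exact: it cancels between `σ` and `-σ`. The quadratic constant is crude. -/
theorem one_add_mul_one_add_rpow_sub_one_rpow_le {r q θ σ : ℝ} (hr : 0 < r) (hq : 0 < q)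
    (hθ0 : 0 ≤ θ) (hθ1 : θ ≤ 1) (hσ1 : -1 < σ)
    (hσ : |σ| ≤ 1 / (4 * (r + q))) :
    (1 + θ * ((1 + σ) ^ q - 1)) ^ (r / q) ≤ 1 + r * θ * σ + (r * q + 4 * r ^ 2) * σ ^ 2 := by
  have hσ' : (r + q) * |σ| ≤ 1 / 4 := by
    rw [le_div_iff₀ (by positivity)] at hσ
    linarith
  have hqσ : q * |σ| ≤ 1 / 4 := by nlinarith [abs_nonneg σ]
  have hrσ : r * |σ| ≤ 1 / 4 := by nlinarith [abs_nonneg σ]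
  have h1 := one_add_rpow_le hq.le hσ1 (by rw [abs_mul, abs_of_pos hq]; linarith)
  have h0 : 0 ≤ (1 + σ) ^ q := Real.rpow_nonneg (by linarith) q
  set u := θ * (q * σ + (q * σ) ^ 2) with hu
  have hu1 : |q * σ + (q * σ) ^ 2| ≤ 2 * (q * |σ|) := by
    have h2 : (q * σ) ^ 2 = (q * |σ|) ^ 2 := by rw [mul_pow, mul_pow, sq_abs]
    have h3 : |q * σ| = q * |σ| := by rw [abs_mul, abs_of_pos hq]
    refine (abs_add_le _ _).trans ?_
    rw [h2, h3, abs_of_nonneg (sq_nonneg (q * |σ|))]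
    nlinarith [abs_nonneg σ, mul_nonneg hq.le (abs_nonneg σ)]
  have hu2 : |u| ≤ 2 * (q * |σ|) := by
    rw [hu, abs_mul, abs_of_nonneg hθ0]
    nlinarith [abs_nonneg (q * σ + (q * σ) ^ 2)]
  have hru : |r / q * u| ≤ 2 * (r * |σ|) := by
    rw [abs_mul, abs_of_pos (by positivity)]
    calc r / q * |u| ≤ r / q * (2 * (q * |σ|)) := by gcongr
      _ = 2 * (r * |σ|) := by field_simp
  have h4 := one_add_rpow_le (div_pos hr hq).le (by linarith [neg_abs_le u] : -1 < u)
    (hru.trans (by linarith))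
  have h5 : (1 + θ * ((1 + σ) ^ q - 1)) ^ (r / q) ≤ (1 + u) ^ (r / q) := by
    refine Real.rpow_le_rpow (by nlinarith) ?_ (by positivity)
    rw [hu]
    nlinarith
  have h6 : (r / q * u) ^ 2 ≤ 4 * r ^ 2 * σ ^ 2 := by
    rw [← sq_abs]
    calc |r / q * u| ^ 2 ≤ (2 * (r * |σ|)) ^ 2 := by gcongr
      _ = 4 * r ^ 2 * σ ^ 2 := by rw [mul_pow, mul_pow, sq_abs]; ring
  have h7 : r / q * u = r * θ * σ + θ * (r * q * σ ^ 2) := by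
    rw [hu]
    field_simp
  have h8 : θ * (r * q * σ ^ 2) ≤ 1 * (r * q * σ ^ 2) := by gcongr
  linarith

theorem lpPairNorm_rpow_div {p : ℝ≥0∞} (hp : p ≠ ∞) {a b : ℝ} (ha : 0 ≤ a)
    (hb : 0 ≤ b) (r : ℝ) :
    lpPairNorm p a b ^ r = (a ^ p.toReal + b ^ p.toReal) ^ (r / p.toReal) := by
  rw [lpPairNorm_of_ne_top hp, ← Real.rpow_mul (by positivity), one_div_mul_eq_div]

/-! ### Planes that cannot carry the norm forced by two non-commuting projections -/

section PlaneNorm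

variable {E : Type*} [NormedAddCommGroup E] [NormedSpace ℝ E] {a c : E} {p q : ℝ≥0∞} {β Y Z : ℝ}

theorem norm_rpow_add_eq (hp1 : 1 ≤ p) (hp : p ≠ ∞) (hβ : 0 < β)
    (h : ∀ s t : ℝ, lpPairNorm p ‖s • a + t • c‖ (|s - t| * β) = lpPairNorm q (|s| * Y) (|t| * Z))
    (s t : ℝ) : ‖s • a + t • c‖ ^ p.toReal + (|s - t| * β) ^ p.toReal =
      lpPairNorm q (|s| * Y) (|t| * Z) ^ p.toReal := by
  rw [← h, lpPairNorm_rpow hp1 hp (norm_nonneg _) (by positivity)]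

/-- Near `s = t = 1` the `ℓ^q` side is smooth, so its symmetric second difference along `t = 1 ± σ`
is `O(σ ^ 2)`. By convexity of `‖·‖ ^ p` the other side has second difference at least `2 (σ β) ^
p`, which is larger for small `σ` as `p < 2`. -/
theorem plane_norm_false_of_lt_two (hp1 : 1 ≤ p) (hp2 : p < 2) (hq1 : 1 ≤ q) (hq : q ≠ ∞)
    (hβ : 0 < β) (hY : 0 < Y) (hZ : 0 < Z)
    (h : ∀ s t : ℝ, lpPairNorm p ‖s • a + t • c‖ (|s - t| * β) = lpPairNorm q (|s| * Y) (|t| * Z)) :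
    False := by
  have hp : p ≠ ∞ := (hp2.trans (by simp)).ne
  have hr : 1 ≤ p.toReal := one_le_toReal hp1 hp
  have hr2 : p.toReal < 2 := by
    rw [← ENNReal.toReal_ofNat 2]
    exact (ENNReal.toReal_lt_toReal hp (by simp)).2 hp2
  have hq' : 1 ≤ q.toReal := one_le_toReal hq1 hq
  have key := norm_rpow_add_eq hp1 hp hβ h
  set r := p.toReal
  set q' := q.toReal
  set W := Y ^ q' + Z ^ q' with hW
  have hYq : 0 < Y ^ q' := Real.rpow_pos_of_pos hY _
  have hZq : 0 < Z ^ q' := Real.rpow_pos_of_pos hZ _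
  have hWpos : 0 < W := by positivity
  set θ := Z ^ q' / W with hθ
  have hθ0 : 0 ≤ θ := by positivity
  have hθ1 : θ ≤ 1 := (div_le_one hWpos).2 (by linarith)
  set δ := 1 / (4 * (r + q')) with hδ
  have hδpos : 0 < δ := by positivity
  have hδ1 : δ < 1 := by
    rw [hδ, div_lt_one (by positivity)]
    linarith
  have hG : ∀ σ : ℝ, |σ| < δ → ‖a + (1 + σ) • c‖ ^ r + (|σ| * β) ^ r ≤
      W ^ (r / q') * (1 + r * θ * σ + (r * q' + 4 * r ^ 2) * σ ^ 2) := by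
    intro σ hσ
    have hσ1 : 0 < 1 + σ := by linarith [neg_abs_le σ]
    have h1 := key 1 (1 + σ)
    rw [lpPairNorm_rpow_div hq (by positivity) (by positivity), one_smul, sub_add_cancel_left,
      abs_neg, abs_one, one_mul, abs_of_pos hσ1, Real.mul_rpow hσ1.le hZ.le] at h1
    have h2 : Y ^ q' + (1 + σ) ^ q' * Z ^ q' = W * (1 + θ * ((1 + σ) ^ q' - 1)) := by
      rw [hθ]
      field_simp
      rw [hW]
      ring
    have h3 : 0 ≤ 1 + θ * ((1 + σ) ^ q' - 1) := by
      have := Real.rpow_nonneg hσ1.le q'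
      nlinarith
    rw [h1, h2, Real.mul_rpow hWpos.le h3]
    exact mul_le_mul_of_nonneg_left
      (one_add_mul_one_add_rpow_sub_one_rpow_le (by linarith) (by linarith) hθ0 hθ1 (by linarith)
        hσ.le)
      (by positivity)
  have h1 := key 1 1
  rw [lpPairNorm_rpow_div hq (by positivity) (by positivity), one_smul, one_smul, sub_self,
    abs_zero, zero_mul, Real.zero_rpow (by linarith), add_zero, abs_one, one_mul, one_mul] at h1
  refine false_of_forall_rpow_le (C := W ^ (r / q') * (r * q' + 4 * r ^ 2)) hr2
    (Real.rpow_pos_of_pos hβ r) hδpos fun s hs hsδ => ?_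
  have e1 := hG s (by rwa [abs_of_pos hs])
  have e2 := hG (-s) (by rwa [abs_neg, abs_of_pos hs])
  have hm := norm_rpow_midpoint hr (a + c) (s • c)
  have h2 : a + c + s • c = a + (1 + s) • c := by module
  have h3 : a + c - s • c = a + (1 + -s) • c := by module
  rw [abs_neg] at e2
  rw [abs_of_pos hs, Real.mul_rpow hs.le hβ.le] at e1 e2
  rw [h2, h3, h1] at hm
  rw [Real.rpow_two]
  linarith

/-- The same comparison at the axis point `(1, 0)`, where the `ℓ^q` side varies only by `O(|s| ^ q)`
with `q > 2`, while `((1 - s) β) ^ p` has a second difference of order `s ^ 2`. -/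
theorem plane_norm_false_of_two_lt (hp2 : 2 ≤ p) (hp : p ≠ ∞) (hq2 : 2 < q) (hq : q ≠ ∞)
    (hβ : 0 < β) (hY : 0 < Y) (hZ : 0 < Z)
    (h : ∀ s t : ℝ, lpPairNorm p ‖s • a + t • c‖ (|s - t| * β) = lpPairNorm q (|s| * Y) (|t| * Z)) :
    False := by
  have hp1 : 1 ≤ p := le_trans (by norm_num) hp2
  have hr : 2 ≤ p.toReal := by
    rw [← ENNReal.toReal_ofNat 2]
    exact (ENNReal.toReal_le_toReal (by simp) hp).2 hp2
  have hq' : 2 < q.toReal := by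
    rw [← ENNReal.toReal_ofNat 2]
    exact (ENNReal.toReal_lt_toReal (by simp) hq).2 hq2
  have key := norm_rpow_add_eq hp1 hp hβ h
  set r := p.toReal
  set q' := q.toReal
  set K := r / q' * (Z / Y) ^ q' with hK
  have hKpos : 0 < K := by positivity
  have hr0 : r ≠ 0 := by linarith
  have hq0 : q' ≠ 0 := by linarith
  have h0 := key 1 0
  rw [lpPairNorm_rpow_div hq (by positivity) (by positivity), one_smul, zero_smul, add_zero,
    sub_zero, abs_one, abs_zero, one_mul, one_mul, zero_mul, Real.zero_rpow hq0, add_zero,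
    ← Real.rpow_mul hY.le, mul_div_cancel₀ _ hq0] at h0
  have hG : ∀ s : ℝ, |s| * K ≤ 1 → |s| ≤ 1 → ‖a + s • c‖ ^ r + ((1 - s) * β) ^ r ≤
      Y ^ r * (1 + 2 * (K * |s| ^ q')) := by
    intro s hsK hs1
    have h1 := key 1 s
    have h2 : Y ^ q' + (|s| * Z) ^ q' = Y ^ q' * (1 + (Z / Y) ^ q' * |s| ^ q') := by
      rw [Real.mul_rpow (abs_nonneg s) hZ.le, Real.div_rpow hZ.le hY.le]
      have := Real.rpow_pos_of_pos hY q'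
      field_simp
    have h3 : 0 ≤ (Z / Y) ^ q' * |s| ^ q' := by positivity
    have hs2 : |s| ^ q' ≤ |s| := by
      simpa using Real.rpow_le_rpow_of_exponent_ge' (abs_nonneg s) hs1 (by norm_num : (0:ℝ) ≤ 1)
        (by linarith : 1 ≤ q')
    have h4 : r / q' * ((Z / Y) ^ q' * |s| ^ q') = K * |s| ^ q' := by rw [hK]; ring
    have h5 : K * |s| ^ q' ≤ 1 := by nlinarith
    have h6 : 0 ≤ K * |s| ^ q' := by positivity
    have h7 := one_add_rpow_le (r := r / q') (u := (Z / Y) ^ q' * |s| ^ q') (by positivity)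
      (by linarith)
      (by rw [h4, abs_of_nonneg h6]; exact h5)
    rw [h4] at h7
    rw [lpPairNorm_rpow_div hq (by positivity) (by positivity), one_smul, abs_one, one_mul, h2,
      abs_of_nonneg (by linarith [le_abs_self s]), Real.mul_rpow (Real.rpow_nonneg hY.le _) (by linarith : 0 ≤ 1 + (Z / Y) ^ q' * |s| ^ q'),
      ← Real.rpow_mul hY.le, mul_div_cancel₀ _ hq0] at h1
    rw [h1]
    refine mul_le_mul_of_nonneg_left (h7.trans ?_) (by positivity)
    nlinarith
  have hδ : 0 < min 1 (1 / K) := by positivity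
  refine false_of_forall_rpow_le (c := β ^ r * r) (C := Y ^ r * (4 * K)) hq' (by positivity) hδ
    fun s hs hsδ => ?_
  have hs1 : s < 1 := hsδ.trans_le (min_le_left _ _)
  have hsK : s * K ≤ 1 := by
    have := (hsδ.trans_le (min_le_right _ _)).le
    rwa [le_div_iff₀ hKpos] at this
  have e1 := hG s (by rwa [abs_of_pos hs]) (by rw [abs_of_pos hs]; exact hs1.le)
  have e2 := hG (-s) (by rwa [abs_neg, abs_of_pos hs]) (by rw [abs_neg, abs_of_pos hs]; exact hs1.le)
  rw [abs_neg] at e2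
  rw [abs_of_pos hs, Real.mul_rpow (by linarith) hβ.le] at e1 e2
  have hm := norm_rpow_midpoint (by linarith : 1 ≤ r) a (s • c)
  have h3 : a - s • c = a + (-s) • c := by module
  rw [h3] at hm
  -- Bernoulli for `(1 + t) ^ 2` with exponent `r / 2 ≥ 1` keeps the quadratic term that Bernoulli
  -- for `1 + t` would lose.
  have hB : ∀ t : ℝ, 0 ≤ 1 + t → 1 + r / 2 * (2 * t + t ^ 2) ≤ (1 + t) ^ r := by
    intro t ht
    have h1 := one_add_mul_self_le_rpow_one_add (s := 2 * t + t ^ 2) (p := r / 2) (by nlinarith)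
      (by linarith)
    have h2 : 1 + (2 * t + t ^ 2) = (1 + t) ^ (2 : ℝ) := by rw [Real.rpow_two]; ring
    rwa [h2, ← Real.rpow_mul ht, mul_div_cancel₀ _ (two_ne_zero)] at h1
  have b1 := hB s (by linarith)
  have b2 := hB (-s) (by linarith)
  have hβr : 0 < β ^ r := Real.rpow_pos_of_pos hβ r
  have b3 : (2 + r * s ^ 2) * β ^ r ≤ (1 - s) ^ r * β ^ r + (1 - -s) ^ r * β ^ r := by
    rw [← add_mul]
    refine mul_le_mul_of_nonneg_right ?_ hβr.le
    rw [sub_neg_eq_add, sub_eq_add_neg]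
    linarith
  rw [Real.rpow_two]
  linarith

/-- If `Z ≤ Y`, the maximum equals `Y` at `(1, 0)`, `(1, 1/2)` and `(1, 1)`. Midpoint convexity of
`‖·‖ ^ p` at these points gives `β ^ p ≤ 2 (β / 2) ^ p`, impossible for `p > 1`. -/
theorem plane_norm_false_of_top (hp1 : 1 < p) (hp : p ≠ ∞) (hβ : 0 < β) (hY : 0 < Y) (hZ : 0 < Z)
    (h : ∀ s t : ℝ, lpPairNorm p ‖s • a + t • c‖ (|s - t| * β) = lpPairNorm ∞ (|s| * Y) (|t| * Z)) :
    False := by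
  wlog hYZ : Z ≤ Y generalizing a c Y Z
  · refine this hZ hY (fun s t => ?_) (le_of_not_ge hYZ) (a := c) (c := a)
    rw [lpPairNorm_comm ∞, ← h t s, add_comm, abs_sub_comm]
  have hr : 1 < p.toReal := by
    rw [← ENNReal.toReal_one]
    exact (ENNReal.toReal_lt_toReal (by simp) hp).2 hp1
  have key := norm_rpow_add_eq hp1.le hp hβ h
  have e1 := key 1 (1 / 2)
  have e2 := key 1 1
  have e3 := key 1 0
  simp only [lpPairNorm_top] at e1 e2 e3
  norm_num at e1 e2 e3
  rw [max_eq_left (by linarith)] at e1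
  rw [max_eq_left (by linarith)] at e2
  rw [max_eq_left (by linarith)] at e3
  rw [Real.zero_rpow (by linarith)] at e2
  have hm := norm_rpow_midpoint hr.le (a + (1 / 2 : ℝ) • c) ((1 / 2 : ℝ) • c)
  have h1 : a + (1 / 2 : ℝ) • c + (1 / 2 : ℝ) • c = a + c := by module
  have h2 : a + (1 / 2 : ℝ) • c - (1 / 2 : ℝ) • c = a := by module
  rw [h1, h2] at hm
  rw [Real.mul_rpow (by norm_num) hβ.le] at e1
  have h3 : ((1 : ℝ) / 2) ^ p.toReal < 1 / 2 := by
    simpa using Real.rpow_lt_rpow_of_exponent_gt (by norm_num : (0 : ℝ) < 1 / 2) (by norm_num) hr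
  have h4 : 0 < β ^ p.toReal := Real.rpow_pos_of_pos hβ _
  have h5 := mul_lt_mul_of_pos_right h3 h4
  norm_num at *
  linarith

end PlaneNorm

/-! ### Commuting `L^p`-projections -/

section Commute

variable {E : Type*} [NormedAddCommGroup E] [NormedSpace ℝ E] {p q : ℝ≥0∞} {P Q : E →ₗ[ℝ] E}

/-- `P` is an `L^p`-projection: an idempotent with `‖x‖ = ‖(‖P x‖, ‖x - P x‖)‖_p`. -/
structure IsLpProj (p : ℝ≥0∞) (P : E →ₗ[ℝ] E) : Prop where
  idem : IsProjection P
  norm_eq : ∀ x, lpPairNorm p ‖P x‖ ‖x - P x‖ = ‖x‖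

theorem IsLpProj.compl (hP : IsLpProj p P) : IsLpProj p (LinearMap.id - P) where
  idem x := by
    have := hP.idem x
    simp [this]
  norm_eq x := by
    have h : x - (LinearMap.id - P : E →ₗ[ℝ] E) x = P x := by simp
    rw [h, lpPairNorm_comm, LinearMap.sub_apply, LinearMap.id_apply]
    exact hP.norm_eq x

/-- The pairs of exponents for which the plane spanned by `P Q x` and `x - P Q x` cannot carry the
norm required when `x` is in the range of `P` and `Q x` is not. -/
def IsRigidPair (p q : ℝ≥0∞) : Prop :=
  p ≠ ∞ ∧ ((p < 2 ∧ q ≠ ∞) ∨ (2 ≤ p ∧ 2 < q ∧ q ≠ ∞) ∨ (1 < p ∧ q = ∞))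

theorem IsLpProj.apply_apply_of_apply_eq (hp : 1 ≤ p) (hq : 1 ≤ q) (hpq : IsRigidPair p q)
    (hP : IsLpProj p P) (hQ : IsLpProj q Q) {x : E} (hx : P x = x) : P (Q x) = Q x := by
  by_contra hne
  have hb : Q x - P (Q x) ≠ 0 := fun h => hne (sub_eq_zero.1 h).symm
  have hY : Q x ≠ 0 := fun h => hb (by simp [h])
  have hZ : x - Q x ≠ 0 := fun h => hb (by rw [← sub_eq_zero.1 h, hx, sub_self])
  have h : ∀ s t : ℝ, lpPairNorm p ‖s • P (Q x) + t • (x - P (Q x))‖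
      (|s - t| * ‖Q x - P (Q x)‖) = lpPairNorm q (|s| * ‖Q x‖) (|t| * ‖x - Q x‖) := by
    intro s t
    have e1 := hP.norm_eq (s • Q x + t • (x - Q x))
    have e2 := hQ.norm_eq (s • Q x + t • (x - Q x))
    have f1 : P (s • Q x + t • (x - Q x)) = s • P (Q x) + t • (x - P (Q x)) := by simp [hx]
    have f2 : s • Q x + t • (x - Q x) - (s • P (Q x) + t • (x - P (Q x))) =
      (s - t) • (Q x - P (Q x)) := by module
    have f3 : Q (s • Q x + t • (x - Q x)) = s • Q x := by simp [hQ.idem x]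
    rw [f1, f2, norm_smul, Real.norm_eq_abs] at e1
    rw [f3, add_sub_cancel_left, norm_smul, norm_smul, Real.norm_eq_abs, Real.norm_eq_abs] at e2
    rw [e1, e2]
  obtain ⟨hpt, ⟨h1, h2⟩ | ⟨h1, h2, h3⟩ | ⟨h1, rfl⟩⟩ := hpq
  · exact plane_norm_false_of_lt_two hp h1 hq h2 (norm_pos_iff.2 hb) (norm_pos_iff.2 hY)
      (norm_pos_iff.2 hZ) h
  · exact plane_norm_false_of_two_lt h1 hpt h2 h3 (norm_pos_iff.2 hb) (norm_pos_iff.2 hY)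
      (norm_pos_iff.2 hZ) h
  · exact plane_norm_false_of_top h1 hpt (norm_pos_iff.2 hb) (norm_pos_iff.2 hY)
      (norm_pos_iff.2 hZ) h

/-- Invariance of the range of `P` under `Q`, applied to `P` and to its complement. -/
theorem IsLpProj.commute_of_isRigidPair (hp : 1 ≤ p) (hq : 1 ≤ q) (hpq : IsRigidPair p q)
    (hP : IsLpProj p P) (hQ : IsLpProj q Q) (x : E) : P (Q x) = Q (P x) := by
  have h1 := hP.apply_apply_of_apply_eq hp hq hpq hQ (hP.idem x)
  have h2 := hP.compl.apply_apply_of_apply_eq hp hq hpq hQ (hP.compl.idem x)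
  simp only [LinearMap.sub_apply, LinearMap.id_apply, map_sub, h1] at h2
  rw [sub_self, sub_zero] at h2
  exact sub_right_injective h2

theorem isRigidPair_or (hp : 1 ≤ p) (hq : 1 ≤ q) (h2 : ¬(p = 2 ∧ q = 2))
    (htop : ¬(p = ∞ ∧ q = ∞)) (h1 : ¬(p = 1 ∧ q = ∞)) (h1' : ¬(p = ∞ ∧ q = 1)) :
    IsRigidPair p q ∨ IsRigidPair q p := by
  by_cases hpt : p = ∞
  · have hqt : q ≠ ∞ := fun h => htop ⟨hpt, h⟩
    have hq1 : 1 < q := lt_of_le_of_ne hq fun h => h1' ⟨hpt, h.symm⟩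
    exact Or.inr ⟨hqt, Or.inr (Or.inr ⟨hq1, hpt⟩)⟩
  by_cases hqt : q = ∞
  · have hp1 : 1 < p := lt_of_le_of_ne hp fun h => h1 ⟨h.symm, hqt⟩
    exact Or.inl ⟨hpt, Or.inr (Or.inr ⟨hp1, hqt⟩)⟩
  rcases lt_or_ge p 2 with h | h
  · exact Or.inl ⟨hpt, Or.inl ⟨h, hqt⟩⟩
  rcases lt_or_ge q 2 with h' | h'
  · exact Or.inr ⟨hqt, Or.inl ⟨h', hpt⟩⟩
  by_cases h3 : q = 2
  · have h4 : 2 < p := lt_of_le_of_ne h fun h4 => h2 ⟨h4.symm, h3⟩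
    exact Or.inr ⟨hqt, Or.inr (Or.inl ⟨h', h4, hpt⟩)⟩
  · exact Or.inl ⟨hpt, Or.inr (Or.inl ⟨h, lt_of_le_of_ne h' (Ne.symm h3), hqt⟩)⟩

theorem IsLpProj.eq_of_corner (hp : 1 ≤ p) (hq : 1 ≤ q) (hP : IsLpProj p P) (hQ : IsLpProj q Q)
    {x y : E} (hx : x ≠ 0) (hy : y ≠ 0) (hPx : P x = x) (hQx : Q x = x) (hPy : P y = 0)
    (hQy : Q y = 0) : p = q := by
  have e1 := hP.norm_eq (‖x‖⁻¹ • x + ‖y‖⁻¹ • y)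
  have e2 := hQ.norm_eq (‖x‖⁻¹ • x + ‖y‖⁻¹ • y)
  simp only [map_add, map_smul, hPx, hQx, hPy, hQy, smul_zero, add_zero, add_sub_cancel_left,
    norm_smul, norm_inv, norm_norm, inv_mul_cancel₀ (norm_ne_zero_iff.2 hx),
    inv_mul_cancel₀ (norm_ne_zero_iff.2 hy)] at e1 e2
  exact eq_of_lpPairNorm_one_one_eq hp hq (e1.trans e2.symm)

theorem IsLpProj.eq_of_commute (hp : 1 ≤ p) (hq : 1 ≤ q) (hP : IsLpProj p P) (hQ : IsLpProj q Q)
    (hPQ : ∀ x, P (Q x) = Q (P x)) (hP' : IsNontrivialProjection P)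
    (hQ' : IsNontrivialProjection Q) : p = q := by
  by_contra hne
  -- For `p ≠ q`, two opposite corners of the decomposition by `P` and `Q` cannot both be nonzero.
  -- Using this for `Q` and for its complement makes two adjacent corners vanish, so one projection
  -- is trivial.
  have hcorner : ∀ {P Q : E →ₗ[ℝ] E}, IsLpProj p P → IsLpProj q Q → (∀ x, P (Q x) = Q (P x)) →
      (∀ x, P (Q x) = 0) ∨ (∀ x, x - P x - Q (x - P x) = 0) := by
    intro P Q hP hQ hPQ
    by_contra! h
    obtain ⟨⟨x, hx⟩, y, hy⟩ := h
    refine hne (hP.eq_of_corner hp hq hQ hx hy (hP.idem _) ?_ ?_ ?_)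
    · rw [hPQ, hQ.idem]
    · rw [map_sub, hPQ, map_sub, hP.idem]
      simp
    · rw [map_sub, hQ.idem, sub_self]
  have h1 := hcorner hP hQ hPQ
  have h2 := hcorner hP hQ.compl (fun x => by simp [hPQ])
  obtain ⟨hP0, hP1⟩ := hP'
  obtain ⟨hQ0, hQ1⟩ := hQ'
  rcases h1 with h1 | h1 <;> rcases h2 with h2 | h2
  · refine hP0 (LinearMap.ext fun x => ?_)
    have := h2 x
    simpa [h1] using this
  · refine hQ0 (LinearMap.ext fun x => ?_)
    have := h2 x
    simpa [← hPQ, h1] using this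
  · refine hQ1 (LinearMap.ext fun x => ?_)
    have e1 := h1 x
    have e2 := h2 x
    simp only [LinearMap.sub_apply, LinearMap.id_apply, map_sub, hPQ] at e1 e2
    rw [← sub_eq_zero.1 e2, sub_sub_sub_cancel_right] at e1
    exact (sub_eq_zero.1 e1).symm
  · refine hP1 (LinearMap.ext fun x => ?_)
    have e1 := h1 x
    have e2 := h2 x
    simp only [LinearMap.sub_apply, LinearMap.id_apply, map_sub] at e1 e2
    have e3 : x - P x = x - P x - (Q x - Q (P x)) + (x - P x - (x - Q x - (P x - Q (P x)))) := by
      abel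
    rw [e1, e2, add_zero] at e3
    exact (sub_eq_zero.1 e3).symm

end Commute

/-! ### Extreme functionals -/

section Extreme

variable {E : Type*} [NormedAddCommGroup E] [NormedSpace ℝ E]

/-- The extreme points of the dual unit ball. -/
def extremeFunctionals (E : Type*) [NormedAddCommGroup E] [NormedSpace ℝ E] :
    Set (StrongDual ℝ E) :=
  (Metric.closedBall (0 : StrongDual ℝ E) 1).extremePoints ℝ

theorem norm_le_one_of_mem_extremeFunctionals {φ : StrongDual ℝ E}
    (hφ : φ ∈ extremeFunctionals E) : ‖φ‖ ≤ 1 := by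
  simpa using hφ.1

theorem eq_of_mem_extremeFunctionals {φ ψ : StrongDual ℝ E} (hφ : φ ∈ extremeFunctionals E)
    (h1 : ‖φ + ψ‖ ≤ 1) (h2 : ‖φ - ψ‖ ≤ 1) : ψ = 0 := by
  have h := hφ.2 (x₁ := φ + ψ) (by simpa using h1) (x₂ := φ - ψ) (by simpa using h2)
    ⟨1 / 2, 1 / 2, by norm_num, by norm_num, by norm_num, by module⟩
  simpa using h

theorem mem_extremeFunctionals_of {φ : StrongDual ℝ E} (hφ : ‖φ‖ ≤ 1)
    (h : ∀ ψ : StrongDual ℝ E, ‖φ + ψ‖ ≤ 1 → ‖φ - ψ‖ ≤ 1 → ψ = 0) :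
    φ ∈ extremeFunctionals E := by
  refine mem_extremePoints_iff_left.2 ⟨by simpa using hφ, ?_⟩
  rintro x₁ hx₁ x₂ hx₂ ⟨a, b, ha, hb, hab, rfl⟩
  have hc := convex_closedBall (0 : StrongDual ℝ E) 1
  have hm : 0 < min a b := lt_min ha hb
  have hma := min_le_left a b
  have hmb := min_le_right a b
  have h1 := hc hx₁ hx₂ (by linarith : 0 ≤ a + min a b) (by linarith : 0 ≤ b - min a b)
    (by linarith)
  have h2 := hc hx₁ hx₂ (by linarith : 0 ≤ a - min a b) (by linarith : 0 ≤ b + min a b)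
    (by linarith)
  -- Moving from `a • x₁ + b • x₂` by `± min a b` along the chord keeps both weights nonnegative.
  have h3 := h (min a b • (x₁ - x₂))
    (by
      rw [mem_closedBall_zero_iff] at h1
      refine (congrArg norm ?_).trans_le h1
      module)
    (by
      rw [mem_closedBall_zero_iff] at h2
      refine (congrArg norm ?_).trans_le h2
      module)
  rw [smul_eq_zero, sub_eq_zero] at h3
  obtain rfl := h3.resolve_left hm.ne'
  rw [← add_smul, hab, one_smul]

/-- By Banach–Alaoglu and Krein–Milman the dual ball is the weak-* closed convex hull of its extreme
points. If all of them vanished at `x`, so would a norming functional of `x`. -/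
theorem exists_extremeFunctional_ne_zero {x : E} (hx : x ≠ 0) :
    ∃ φ ∈ extremeFunctionals E, φ x ≠ 0 := by
  by_contra! h
  set K : Set (WeakDual ℝ E) := WeakDual.toStrongDual ⁻¹' Metric.closedBall 0 1 with hK
  have hKc : IsCompact K := WeakDual.isCompact_closedBall 0 1
  have hKconv : Convex ℝ K :=
    (convex_closedBall (0 : StrongDual ℝ E) 1).linear_preimage
      (WeakDual.toStrongDual (𝕜 := ℝ) (E := E)).toLinearMap
  have : LocallyConvexSpace ℝ (WeakDual ℝ E) :=
    inferInstanceAs (LocallyConvexSpace ℝ (WeakBilin (topDualPairing ℝ E)))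
  have hKM := closure_convexHull_extremePoints hKc hKconv
  obtain ⟨g, hg1, hg2⟩ := exists_dual_vector'' ℝ x
  have hgK : (StrongDual.toWeakDual g) ∈ K := by
    simpa [hK] using hg1
  rw [← hKM] at hgK
  have hcl : IsClosed {φ : WeakDual ℝ E | φ x = 0} :=
    isClosed_eq (WeakDual.eval_continuous x) continuous_const
  have hconv : Convex ℝ {φ : WeakDual ℝ E | φ x = 0} := by
    intro φ hφ ψ hψ a b _ _ _
    simp only [Set.mem_ofPred_eq] at hφ hψ ⊢
    change a • φ x + b • ψ x = 0
    simp [hφ, hψ]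
  have hsub : K.extremePoints ℝ ⊆ {φ : WeakDual ℝ E | φ x = 0} := by
    intro φ hφ
    refine h (WeakDual.toStrongDual φ) ⟨hφ.1, ?_⟩
    intro x₁ hx₁ x₂ hx₂ hseg
    exact hφ.2 (x₁ := StrongDual.toWeakDual x₁) hx₁ (x₂ := StrongDual.toWeakDual x₂) hx₂ hseg
  have := closure_minimal (convexHull_min hsub hconv) hcl hgK
  simp only [Set.mem_ofPred_eq] at this
  change g x = 0 at this
  rw [hg2] at this
  exact hx (norm_eq_zero.1 (by simpa using this))

theorem IsLpProj.exists_clm {p : ℝ≥0∞} (hp : 1 ≤ p) {P : E →ₗ[ℝ] E} (hP : IsLpProj p P) :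
    ∃ P' : E →L[ℝ] E, (P' : E →ₗ[ℝ] E) = P :=
  ⟨P.mkContinuous 1 fun x => by
    rw [one_mul, ← hP.norm_eq x]
    exact (le_max_left _ _).trans (max_le_lpPairNorm hp (norm_nonneg _) (norm_nonneg _)), rfl⟩

variable {P Q : E →L[ℝ] E}

/-- An `L^∞`-decomposition dualises to an `L^1`-decomposition: vectors nearly norming the two
components of `φ` can be added without increasing the maximum norm. -/
theorem opNorm_comp_add_opNorm_comp_le (hQ : IsLpProj ∞ (Q : E →ₗ[ℝ] E)) (φ : StrongDual ℝ E) :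
    ‖φ ∘L Q‖ + ‖φ ∘L (1 - Q)‖ ≤ ‖φ‖ := by
  have hsgn : ∀ a : ℝ, ∃ s : ℝ, |s| = 1 ∧ |a| = s * a := fun a => by
    rcases abs_choice a with h | h
    · exact ⟨1, by simp, by rw [h, one_mul]⟩
    · exact ⟨-1, by simp, by rw [h, neg_one_mul]⟩
  have hi : ∀ x, Q (Q x) = Q x := hQ.idem
  have hn : ∀ x, max ‖Q x‖ ‖x - Q x‖ = ‖x‖ := fun x => by
    rw [← lpPairNorm_top]
    exact hQ.norm_eq x
  have key : ∀ x y, |φ (Q x)| * ‖y‖ + |φ (y - Q y)| * ‖x‖ ≤ ‖φ‖ * (‖x‖ * ‖y‖) := by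
    intro x y
    obtain ⟨s, hs, hs'⟩ := hsgn (φ (Q x))
    obtain ⟨t, ht, ht'⟩ := hsgn (φ (y - Q y))
    set z := (s * ‖y‖) • Q x + (t * ‖x‖) • (y - Q y) with hz
    have hz1 : φ z = |φ (Q x)| * ‖y‖ + |φ (y - Q y)| * ‖x‖ := by
      rw [hs', ht', hz, map_add, map_smul, map_smul, smul_eq_mul, smul_eq_mul]
      ring
    have hQz : Q z = (s * ‖y‖) • Q x := by
      simp [hz, hi]
    have hz2 : ‖z‖ ≤ ‖x‖ * ‖y‖ := by
      rw [← hn z, hQz, hz, add_sub_cancel_left, norm_smul, norm_smul, norm_mul, norm_mul,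
        norm_norm, norm_norm, Real.norm_eq_abs, Real.norm_eq_abs, hs, ht, one_mul, one_mul]
      refine max_le ?_ ?_
      · rw [mul_comm]
        exact mul_le_mul_of_nonneg_right ((le_max_left _ _).trans_eq (hn x)) (norm_nonneg _)
      · exact mul_le_mul_of_nonneg_left ((le_max_right _ _).trans_eq (hn y)) (norm_nonneg _)
    rw [← hz1]
    refine (le_abs_self _).trans ((φ.le_opNorm z).trans ?_)
    exact mul_le_mul_of_nonneg_left hz2 (norm_nonneg _)
  have hg : ‖φ ∘L (1 - Q)‖ ≤ ‖φ‖ := by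
    refine ContinuousLinearMap.opNorm_le_bound _ (norm_nonneg _) fun y => ?_
    refine (φ.le_opNorm _).trans (mul_le_mul_of_nonneg_left ?_ (norm_nonneg _))
    exact (le_max_right _ _).trans_eq (hn y)
  rw [← le_sub_iff_add_le]
  refine ContinuousLinearMap.opNorm_le_bound _ (sub_nonneg.2 hg) fun x => ?_
  rcases eq_or_ne x 0 with rfl | hx
  · simp
  have hx' : 0 < ‖x‖ := norm_pos_iff.2 hx
  have h1 : ‖φ ∘L (1 - Q)‖ ≤ ‖φ‖ - |φ (Q x)| / ‖x‖ := by
    refine ContinuousLinearMap.opNorm_le_bound _ ?_ fun y => ?_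
    · rw [sub_nonneg, div_le_iff₀ hx']
      refine (φ.le_opNorm _).trans (mul_le_mul_of_nonneg_left ?_ (norm_nonneg _))
      exact (le_max_left _ _).trans_eq (hn x)
    · have h2 := key x y
      have h3 : |φ (y - Q y)| ≤ (‖φ‖ * (‖x‖ * ‖y‖) - |φ (Q x)| * ‖y‖) / ‖x‖ := by
        rw [le_div_iff₀ hx']
        linarith
      refine h3.trans_eq ?_
      field_simp
  have h4 : |φ (Q x)| / ‖x‖ ≤ ‖φ‖ - ‖φ ∘L (1 - Q)‖ := by linarith
  rwa [div_le_iff₀ hx'] at h4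

theorem comp_eq_or_of_mem_extremeFunctionals (hQ : IsLpProj ∞ (Q : E →ₗ[ℝ] E))
    {φ : StrongDual ℝ E} (hφ : φ ∈ extremeFunctionals E) : φ ∘L Q = φ ∨ φ ∘L Q = 0 := by
  have h := (opNorm_comp_add_opNorm_comp_le hQ φ).trans (norm_le_one_of_mem_extremeFunctionals hφ)
  set f := φ ∘L Q with hf
  set g := φ ∘L (1 - Q) with hg
  have hfg : φ = f + g := by
    rw [hf, hg]
    ext x
    simp
  by_contra! hne
  have hf0 : 0 < ‖f‖ := norm_pos_iff.2 hne.2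
  have hg0 : 0 < ‖g‖ := norm_pos_iff.2 fun h0 => hne.1 (by rw [hfg, h0, add_zero])
  have hf1 : ‖f‖ ≤ 1 := by linarith
  have hg1 : ‖g‖ ≤ 1 := by linarith
  -- This perturbation moves mass between `f` and `g` while keeping the bound `‖f‖ + ‖g‖`. Its
  -- vanishing, composed with `Q`, gives `‖g‖ • f = 0`.
  have h0 := eq_of_mem_extremeFunctionals hφ (ψ := ‖g‖ • f - ‖f‖ • g)
    (by
      have e : φ + (‖g‖ • f - ‖f‖ • g) = (1 + ‖g‖) • f + (1 - ‖f‖) • g := by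
        rw [hfg]; module
      rw [e]
      refine (norm_add_le _ _).trans ?_
      rw [norm_smul, norm_smul, Real.norm_of_nonneg (by linarith), Real.norm_of_nonneg (by linarith)]
      linarith)
    (by
      have e : φ - (‖g‖ • f - ‖f‖ • g) = (1 - ‖g‖) • f + (1 + ‖f‖) • g := by
        rw [hfg]; module
      rw [e]
      refine (norm_add_le _ _).trans ?_
      rw [norm_smul, norm_smul, Real.norm_of_nonneg (by linarith), Real.norm_of_nonneg (by linarith)]
      linarith)
  refine hne.2 (ContinuousLinearMap.ext fun x => ?_)
  have hx := DFunLike.congr_fun h0 (Q x)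
  have hi : Q (Q x) = Q x := hQ.idem x
  simp only [hf, hg, sub_apply, smul_apply,
    ContinuousLinearMap.comp_apply, one_apply_eq_self, hi, sub_self, map_zero,
    smul_zero, sub_zero, zero_apply, smul_eq_zero] at hx
  exact hx.resolve_left hg0.ne'

theorem IsLpProj.commute_of_top (hP : IsLpProj ∞ (P : E →ₗ[ℝ] E))
    (hQ : IsLpProj ∞ (Q : E →ₗ[ℝ] E)) (x : E) : P (Q x) = Q (P x) := by
  by_contra hne
  obtain ⟨φ, hφ, h⟩ := exists_extremeFunctional_ne_zero (sub_ne_zero.2 hne)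
  refine h ?_
  have h1 : (∀ y, φ (P y) = φ y) ∨ ∀ y, φ (P y) = 0 :=
    (comp_eq_or_of_mem_extremeFunctionals hP hφ).imp DFunLike.congr_fun DFunLike.congr_fun
  have h2 : (∀ y, φ (Q y) = φ y) ∨ ∀ y, φ (Q y) = 0 :=
    (comp_eq_or_of_mem_extremeFunctionals hQ hφ).imp DFunLike.congr_fun DFunLike.congr_fun
  rcases h1 with h1 | h1 <;> rcases h2 with h2 | h2 <;> simp [h1, h2]

/-! ### An `L^1`-projection together with an `L^∞`-projection -/

theorem norm_comp_add_comp_le_one (hP : IsLpProj 1 (P : E →ₗ[ℝ] E)) {φ ψ : StrongDual ℝ E}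
    (hφ : ‖φ‖ ≤ 1) (hψ : ‖ψ‖ ≤ 1) : ‖φ ∘L P + ψ ∘L (1 - P)‖ ≤ 1 := by
  refine ContinuousLinearMap.opNorm_le_bound _ zero_le_one fun x => ?_
  have h := hP.norm_eq x
  simp only [lpPairNorm_of_ne_top ENNReal.one_ne_top, ENNReal.toReal_one, Real.rpow_one, div_one,
    ContinuousLinearMap.coe_coe] at h
  rw [one_mul, ← h]
  refine (norm_add_le _ _).trans (add_le_add ?_ ?_)
  · exact (φ.le_of_opNorm_le hφ (P x)).trans_eq (one_mul _)
  · exact (ψ.le_of_opNorm_le hψ (x - P x)).trans_eq (one_mul _)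

theorem neg_mem_extremeFunctionals {φ : StrongDual ℝ E} (hφ : φ ∈ extremeFunctionals E) :
    -φ ∈ extremeFunctionals E := by
  refine mem_extremeFunctionals_of
    (by rw [norm_neg]; exact norm_le_one_of_mem_extremeFunctionals hφ) fun ψ h1 h2 => ?_
  refine eq_of_mem_extremeFunctionals hφ ?_ ?_
  · rwa [← norm_neg, neg_add, ← sub_eq_add_neg]
  · rwa [← norm_neg, neg_sub, sub_eq_neg_add]

/-- The dual ball is the product of the balls of the two components, so components of extreme points
can be recombined freely. -/
theorem comp_add_comp_mem_extremeFunctionals (hP : IsLpProj 1 (P : E →ₗ[ℝ] E))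
    {φ ψ : StrongDual ℝ E} (hφ : φ ∈ extremeFunctionals E) (hψ : ψ ∈ extremeFunctionals E) :
    φ ∘L P + ψ ∘L (1 - P) ∈ extremeFunctionals E := by
  have hφ1 := norm_le_one_of_mem_extremeFunctionals hφ
  have hψ1 := norm_le_one_of_mem_extremeFunctionals hψ
  have hi : ∀ x, P (P x) = P x := hP.idem
  refine mem_extremeFunctionals_of (norm_comp_add_comp_le_one hP hφ1 hψ1) fun χ h1 h2 => ?_
  have e1 : χ ∘L P = 0 := by
    refine eq_of_mem_extremeFunctionals hφ ?_ ?_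
    · convert norm_comp_add_comp_le_one hP h1 hφ1 using 2
      ext x
      simp [hi]
      ring
    · convert norm_comp_add_comp_le_one hP h2 hφ1 using 2
      ext x
      simp [hi]
  have e2 : χ ∘L (1 - P) = 0 := by
    refine eq_of_mem_extremeFunctionals hψ ?_ ?_
    · convert norm_comp_add_comp_le_one hP hψ1 h1 using 2
      ext x
      simp [hi]
      ring
    · convert norm_comp_add_comp_le_one hP hψ1 h2 using 2
      ext x
      simp [hi]
      ring
  have e3 : χ = χ ∘L P + χ ∘L (1 - P) := by
    ext x
    simp
  rw [e3, e1, e2, add_zero]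

/-- If the `P`-component of `φ` were zero, `φ ± ψ ∘L P` would stay in the dual ball for every `ψ` in
it. -/
theorem comp_ne_zero_of_mem_extremeFunctionals (hP : IsLpProj 1 (P : E →ₗ[ℝ] E)) (hP0 : P ≠ 0)
    {φ : StrongDual ℝ E} (hφ : φ ∈ extremeFunctionals E) : φ ∘L P ≠ 0 := by
  intro h
  obtain ⟨x, hx⟩ := DFunLike.ne_iff.1 hP0
  obtain ⟨ψ, hψ, hψx⟩ := exists_extremeFunctional_ne_zero hx
  refine hψx (DFunLike.congr_fun (?_ : ψ ∘L P = 0) x)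
  have hφP : ∀ y, φ (P y) = 0 := DFunLike.congr_fun h
  have hφ1 := norm_le_one_of_mem_extremeFunctionals hφ
  have hψ1 := norm_le_one_of_mem_extremeFunctionals hψ
  refine eq_of_mem_extremeFunctionals hφ ?_ ?_
  · convert norm_comp_add_comp_le_one hP hψ1 hφ1 using 2
    ext y
    simp [hφP]
    ring
  · convert norm_comp_add_comp_le_one hP (norm_neg ψ ▸ hψ1) hφ1 using 2
    ext y
    simp [hφP]
    ring

theorem exists_smul_of_mem_extremeFunctionals (hQ : IsLpProj ∞ (Q : E →ₗ[ℝ] E))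
    {φ : StrongDual ℝ E} (hφ : φ ∈ extremeFunctionals E) :
    ∃ τ : ℝ, τ * τ = 1 ∧ φ ∘L (2 • Q - 1) = τ • φ := by
  rcases comp_eq_or_of_mem_extremeFunctionals hQ hφ with h | h
  · refine ⟨1, by norm_num, ?_⟩
    ext x
    have := DFunLike.congr_fun h x
    simp only [ContinuousLinearMap.comp_apply] at this
    simp [this]
    ring
  · refine ⟨-1, by norm_num, ?_⟩
    ext x
    have := DFunLike.congr_fun h x
    simp only [ContinuousLinearMap.comp_apply, zero_apply] at this
    simp [this]

/-- The reflection `2 Q - 1` either multiplies the two components of an extreme functional by a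
common sign, or interchanges them up to sign. -/
theorem fixes_or_swaps_of_mem_extremeFunctionals (hP : IsLpProj 1 (P : E →ₗ[ℝ] E))
    (hQ : IsLpProj ∞ (Q : E →ₗ[ℝ] E)) {φ ψ : StrongDual ℝ E} (hφ : φ ∈ extremeFunctionals E)
    (hψ : ψ ∈ extremeFunctionals E) : ∃ τ : ℝ, τ * τ = 1 ∧
      (((φ ∘L P) ∘L (2 • Q - 1) = τ • (φ ∘L P) ∧
          (ψ ∘L (1 - P)) ∘L (2 • Q - 1) = τ • (ψ ∘L (1 - P))) ∨
        ((φ ∘L P) ∘L (2 • Q - 1) = τ • (ψ ∘L (1 - P)) ∧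
          (ψ ∘L (1 - P)) ∘L (2 • Q - 1) = τ • (φ ∘L P))) := by
  obtain ⟨τ, hτ, h1⟩ := exists_smul_of_mem_extremeFunctionals hQ
    (comp_add_comp_mem_extremeFunctionals hP hφ hψ)
  obtain ⟨σ, hσ, h2⟩ := exists_smul_of_mem_extremeFunctionals hQ
    (comp_add_comp_mem_extremeFunctionals hP hφ (neg_mem_extremeFunctionals hψ))
  rw [ContinuousLinearMap.neg_comp] at h2
  rw [ContinuousLinearMap.add_comp] at h1 h2
  rw [ContinuousLinearMap.neg_comp] at h2
  set f := φ ∘L P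
  set g := ψ ∘L (1 - P)
  set W := 2 • Q - 1
  have hf : f ∘L W = (1 / 2 : ℝ) • (τ • (f + g) + σ • (f + -g)) := by
    rw [← h1, ← h2]; module
  have hg : g ∘L W = (1 / 2 : ℝ) • (τ • (f + g) - σ • (f + -g)) := by
    rw [← h1, ← h2]; module
  refine ⟨τ, hτ, ?_⟩
  -- `f + g` and `f - g` are both eigenvectors of the reflection: equal signs fix the components,
  -- opposite signs swap them.
  rcases mul_self_eq_mul_self_iff.1 (hσ.trans hτ.symm) with rfl | rfl
  · exact Or.inl ⟨by rw [hf]; module, by rw [hg]; module⟩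
  · exact Or.inr ⟨by rw [hf]; module, by rw [hg]; module⟩

theorem eq_zero_of_smul_comp_eq (hP : IsLpProj 1 (P : E →ₗ[ℝ] E)) {φ ψ : StrongDual ℝ E} {s t : ℝ}
    (hs : s * s = 1) (h : s • (φ ∘L P) = t • (ψ ∘L (1 - P))) : φ ∘L P = 0 := by
  have hi : ∀ x, P (P x) = P x := hP.idem
  ext x
  have h1 := DFunLike.congr_fun h (P x)
  simp [hi] at h1
  rcases h1 with rfl | h1
  · norm_num at hs
  · simp [h1]

theorem IsLpProj.rank_le_two (hP : IsLpProj 1 (P : E →ₗ[ℝ] E)) (hQ : IsLpProj ∞ (Q : E →ₗ[ℝ] E))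
    (hP0 : P ≠ 0) (hP1 : P ≠ 1) (hQ0 : Q ≠ 0) (hQ1 : Q ≠ 1) : Module.rank ℝ E ≤ 2 := by
  have hR : IsLpProj 1 ((1 - P : E →L[ℝ] E) : E →ₗ[ℝ] E) := hP.compl
  have hf0 := fun {φ : StrongDual ℝ E} (hφ : φ ∈ extremeFunctionals E) =>
    comp_ne_zero_of_mem_extremeFunctionals hP hP0 hφ
  have hg0 := fun {φ : StrongDual ℝ E} (hφ : φ ∈ extremeFunctionals E) =>
    comp_ne_zero_of_mem_extremeFunctionals hR (sub_ne_zero.2 hP1.symm) hφ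
  have hR' : (1 : E →L[ℝ] E) - (1 - P) = P := sub_sub_cancel _ _
  have swaps : ∀ φ ∈ extremeFunctionals E, ∀ ψ ∈ extremeFunctionals E, ∃ τ : ℝ, τ * τ = 1 ∧
      (φ ∘L P) ∘L (2 • Q - 1) = τ • (ψ ∘L (1 - P)) ∧
      (ψ ∘L (1 - P)) ∘L (2 • Q - 1) = τ • (φ ∘L P) := by
    intro φ hφ ψ hψ
    obtain ⟨τ, hτ, ⟨hf, hg⟩ | h⟩ := fixes_or_swaps_of_mem_extremeFunctionals hP hQ hφ hψ
    swap
    · exact ⟨τ, hτ, h⟩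
    -- One fixed pair propagates its sign `τ` to every extreme functional. Then `2 Q - 1 = τ`, so
    -- `Q` is trivial.
    exfalso
    have hψ' : ∀ χ ∈ extremeFunctionals E,
        (χ ∘L (1 - P)) ∘L (2 • Q - 1) = τ • (χ ∘L (1 - P)) := by
      intro χ hχ
      obtain ⟨σ, hσ, ⟨hf', hg'⟩ | ⟨hf', -⟩⟩ := fixes_or_swaps_of_mem_extremeFunctionals hP hQ hφ hχ
      · rw [hg', smul_left_injective ℝ (hf0 hφ) (hf'.symm.trans hf)]
      · exact absurd (eq_zero_of_smul_comp_eq hP hτ (hf.symm.trans hf')) (hf0 hφ)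
    have hφ' : ∀ χ ∈ extremeFunctionals E, (χ ∘L P) ∘L (2 • Q - 1) = τ • (χ ∘L P) := by
      intro χ hχ
      obtain ⟨σ, hσ, ⟨hf', hg'⟩ | ⟨-, hg'⟩⟩ := fixes_or_swaps_of_mem_extremeFunctionals hP hQ hχ hψ
      · rw [hf', smul_left_injective ℝ (hg0 hψ) (hg'.symm.trans hg)]
      · have h := hg.symm.trans hg'
        rw [← hR'] at h
        nth_rewrite 1 [hR'] at h
        exact absurd (eq_zero_of_smul_comp_eq hR hτ h) (hg0 hψ)
    have hW : ∀ x, (2 : ℝ) • Q x - x = τ • x := by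
      intro x
      by_contra hne
      obtain ⟨χ, hχ, h⟩ := exists_extremeFunctional_ne_zero (sub_ne_zero.2 hne)
      have h1 := DFunLike.congr_fun (hφ' χ hχ) x
      have h2 := DFunLike.congr_fun (hψ' χ hχ) x
      refine h ?_
      simp at h1 h2 ⊢
      linarith
    rcases mul_self_eq_one_iff.1 hτ with rfl | rfl
    · refine hQ1 (ContinuousLinearMap.ext fun x => ?_)
      have h := hW x
      rw [one_smul, sub_eq_iff_eq_add, ← two_smul ℝ x] at h
      exact smul_right_injective E (two_ne_zero' ℝ) h
    · refine hQ0 (ContinuousLinearMap.ext fun x => ?_)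
      have h := hW x
      rw [neg_one_smul, sub_eq_neg_self] at h
      exact (smul_eq_zero.1 h).resolve_left two_ne_zero
  obtain ⟨x₀, hx₀⟩ := DFunLike.ne_iff.1 hP0
  obtain ⟨φ, hφ, -⟩ := exists_extremeFunctional_ne_zero hx₀
  -- As every pair is swapped, each component of any extreme `ψ` is a multiple of the corresponding
  -- component of `φ`. These two components therefore separate points.
  have hinj : Function.Injective
      (((φ ∘L P : StrongDual ℝ E) : E →ₗ[ℝ] ℝ).prod ((φ ∘L (1 - P) : StrongDual ℝ E) : E →ₗ[ℝ] ℝ)) := by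
    rw [← LinearMap.ker_eq_bot, LinearMap.ker_eq_bot']
    intro x hx
    by_contra hne
    obtain ⟨ψ, hψ, hψx⟩ := exists_extremeFunctional_ne_zero hne
    obtain ⟨τ, hτ, h1, h2⟩ := swaps φ hφ φ hφ
    obtain ⟨τ₁, hτ₁, h3, -⟩ := swaps φ hφ ψ hψ
    obtain ⟨τ₂, hτ₂, -, h4⟩ := swaps ψ hψ φ hφ
    have e1 := DFunLike.congr_fun (h1.symm.trans h3) x
    have e2 := DFunLike.congr_fun (h2.symm.trans h4) x
    have h5 := congrArg Prod.fst hx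
    have h6 := congrArg Prod.snd hx
    have n1 : τ₁ ≠ 0 := by rintro rfl; norm_num at hτ₁
    have n2 : τ₂ ≠ 0 := by rintro rfl; norm_num at hτ₂
    simp at e1 e2 h5 h6
    refine hψx ?_
    simp [h5, n2] at e2
    have h7 : φ x = 0 := by linarith
    simpa [h5, h7, n1, e2] using e1
  have := LinearMap.lift_rank_le_of_injective _ hinj
  simpa [one_add_one_eq_two] using this

end Extreme

/-! ### Behrends' theorem -/

section Behrends

variable {E : Type*} [NormedAddCommGroup E] [NormedSpace ℝ E] {p q : ℝ≥0∞} {P Q : E →ₗ[ℝ] E}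

theorem IsLpProj.not_one_top (hE : 2 < Module.rank ℝ E) (hP : IsLpProj 1 P) (hQ : IsLpProj ∞ Q)
    (hP' : IsNontrivialProjection P) (hQ' : IsNontrivialProjection Q) : False := by
  obtain ⟨P, rfl⟩ := hP.exists_clm le_rfl
  obtain ⟨Q, rfl⟩ := hQ.exists_clm le_top
  refine hE.not_ge (hP.rank_le_two hQ ?_ ?_ ?_ ?_)
  · rintro rfl; exact hP'.1 rfl
  · rintro rfl; exact hP'.2 rfl
  · rintro rfl; exact hQ'.1 rfl
  · rintro rfl; exact hQ'.2 rfl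

theorem commute_of_not_isNontrivialProjection (h : ¬IsNontrivialProjection P) (x : E) :
    P (Q x) = Q (P x) := by
  unfold IsNontrivialProjection at h
  rcases not_and_or.1 h with h | h <;> rw [not_not.1 h] <;> simp

/-- **Behrends' theorem**: `L^p`- and `L^q`-projections commute, unless `p = q = 2`. -/
theorem IsLpProj.commute (hE : 2 < Module.rank ℝ E) (hp : 1 ≤ p) (hq : 1 ≤ q)
    (hpq : ¬(p = 2 ∧ q = 2)) (hP : IsLpProj p P) (hQ : IsLpProj q Q) (x : E) :
    P (Q x) = Q (P x) := by
  by_cases hP' : IsNontrivialProjection P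
  swap
  · exact commute_of_not_isNontrivialProjection hP' x
  by_cases hQ' : IsNontrivialProjection Q
  swap
  · exact (commute_of_not_isNontrivialProjection hQ' x).symm
  by_cases htop : p = ∞ ∧ q = ∞
  · obtain ⟨rfl, rfl⟩ := htop
    obtain ⟨P, rfl⟩ := hP.exists_clm hp
    obtain ⟨Q, rfl⟩ := hQ.exists_clm hq
    exact hP.commute_of_top hQ x
  by_cases h1 : p = 1 ∧ q = ∞
  · obtain ⟨rfl, rfl⟩ := h1
    exact (hP.not_one_top hE hQ hP' hQ').elim
  by_cases h2 : p = ∞ ∧ q = 1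
  · obtain ⟨rfl, rfl⟩ := h2
    exact (hQ.not_one_top hE hP hQ' hP').elim
  rcases isRigidPair_or hp hq hpq htop h1 h2 with h | h
  · exact hP.commute_of_isRigidPair hp hq h hQ x
  · exact (hQ.commute_of_isRigidPair hq hp h hP x).symm

theorem IsLpProj.exponent_eq (hE : 2 < Module.rank ℝ E) (hp : 1 ≤ p) (hq : 1 ≤ q)
    (hP : IsLpProj p P) (hQ : IsLpProj q Q)
    (hP' : IsNontrivialProjection P) (hQ' : IsNontrivialProjection Q) : p = q := by
  by_cases hpq : p = 2 ∧ q = 2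
  · exact hpq.1.trans hpq.2.symm
  · exact hP.eq_of_commute hp hq hQ (hP.commute hE hp hq hpq hQ) hP' hQ'

end Behrends

/-! ### Ultraproducts of normed spaces -/

section Ultraproduct

variable (E : ℕ → Type u) [∀ n, NormedAddCommGroup (E n)] [∀ n, NormedSpace ℝ (E n)]

/-- The bounded sequences in `∏ n, E n`. -/
def boundedSequences : Submodule ℝ (∀ n, E n) where
  carrier := {x | ∃ C : ℝ, ∀ n, ‖x n‖ ≤ C}
  add_mem' := by
    rintro x y ⟨C, hC⟩ ⟨D, hD⟩
    exact ⟨C + D, fun n => norm_add_le_of_le (hC n) (hD n)⟩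
  zero_mem' := ⟨0, fun n => by simp⟩
  smul_mem' := by
    rintro c x ⟨C, hC⟩
    refine ⟨‖c‖ * C, fun n => ?_⟩
    rw [Pi.smul_apply, norm_smul]
    exact mul_le_mul_of_nonneg_left (hC n) (norm_nonneg _)

/-- The bounded sequences in `∏ n, E n`, to be seminormed by the limit of the norms along an
ultrafilter. -/
def BoundedSeq : Type u := boundedSequences E

instance : AddCommGroup (BoundedSeq E) := inferInstanceAs (AddCommGroup (boundedSequences E))

instance : Module ℝ (BoundedSeq E) := inferInstanceAs (Module ℝ (boundedSequences E))

variable {E}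

/-- The `n`-th term of a bounded sequence. -/
def BoundedSeq.term (x : BoundedSeq E) (n : ℕ) : E n := x.1 n

theorem exists_tendsto_hyperfilter {a : ℕ → ℝ} {C : ℝ} (h0 : ∀ n, 0 ≤ a n) (hC : ∀ n, a n ≤ C) :
    ∃ L, Tendsto a (hyperfilter ℕ : Filter ℕ) (𝓝 L) := by
  have h := isCompact_Icc.ultrafilter_le_nhds ((hyperfilter ℕ).map a) (s := Set.Icc 0 C)
    (by
      rw [Ultrafilter.coe_map]
      exact tendsto_principal.2 (Eventually.of_forall fun n => ⟨h0 n, hC n⟩))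
  obtain ⟨L, -, hL⟩ := h
  exact ⟨L, hL⟩

theorem BoundedSeq.exists_tendsto (x : BoundedSeq E) :
    ∃ L, Tendsto (fun n => ‖x.term n‖) (hyperfilter ℕ : Filter ℕ) (𝓝 L) := by
  obtain ⟨C, hC⟩ := x.2
  exact exists_tendsto_hyperfilter (fun _ => norm_nonneg _) hC

/-- The limit of the norms of the terms along the hyperfilter. -/
noncomputable def BoundedSeq.limNorm (x : BoundedSeq E) : ℝ := x.exists_tendsto.choose

theorem BoundedSeq.tendsto_limNorm (x : BoundedSeq E) :
    Tendsto (fun n => ‖x.term n‖) (hyperfilter ℕ : Filter ℕ) (𝓝 x.limNorm) :=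
  x.exists_tendsto.choose_spec

theorem BoundedSeq.limNorm_eq_of_tendsto {x : BoundedSeq E} {L : ℝ}
    (h : Tendsto (fun n => ‖x.term n‖) (hyperfilter ℕ : Filter ℕ) (𝓝 L)) : x.limNorm = L :=
  tendsto_nhds_unique x.tendsto_limNorm h

noncomputable instance : SeminormedAddCommGroup (BoundedSeq E) :=
  AddGroupSeminorm.toSeminormedAddCommGroup
    { toFun := BoundedSeq.limNorm
      map_zero' := BoundedSeq.limNorm_eq_of_tendsto (by
        have : ∀ n, ‖(0 : BoundedSeq E).term n‖ = 0 := fun n => norm_zero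
        simp only [this]
        exact tendsto_const_nhds)
      add_le' := fun x y => le_of_tendsto_of_tendsto' (x + y).tendsto_limNorm
        (x.tendsto_limNorm.add y.tendsto_limNorm) fun n => norm_add_le (x.term n) (y.term n)
      neg' := fun x => BoundedSeq.limNorm_eq_of_tendsto (by
        have : ∀ n, ‖(-x).term n‖ = ‖x.term n‖ := fun n => norm_neg (x.term n)
        simp only [this]
        exact x.tendsto_limNorm) }

theorem BoundedSeq.tendsto_norm (x : BoundedSeq E) :
    Tendsto (fun n => ‖x.term n‖) (hyperfilter ℕ : Filter ℕ) (𝓝 ‖x‖) :=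
  x.tendsto_limNorm

noncomputable instance : NormedSpace ℝ (BoundedSeq E) where
  norm_smul_le c x := le_of_eq <| BoundedSeq.limNorm_eq_of_tendsto (by
    have : ∀ n, ‖(c • x).term n‖ = ‖c‖ * ‖x.term n‖ := fun n => norm_smul c (x.term n)
    simp only [this]
    exact x.tendsto_norm.const_mul _)

/-- A uniformly bounded sequence of linear maps acts on bounded sequences. -/
noncomputable def BoundedSeq.map (T : ∀ n, E n →ₗ[ℝ] E n) {C : ℝ} (hT : ∀ n x, ‖T n x‖ ≤ C * ‖x‖) :
    BoundedSeq E →L[ℝ] BoundedSeq E :=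
  LinearMap.mkContinuous
    { toFun := fun x => ⟨fun n => T n (x.term n), by
        obtain ⟨D, hD⟩ := x.2
        refine ⟨|C| * D, fun n => (hT n _).trans ?_⟩
        exact mul_le_mul (le_abs_self C) (hD n) (norm_nonneg _) (abs_nonneg _)⟩
      map_add' := fun x y => Subtype.ext (funext fun n => map_add (T n) (x.term n) (y.term n))
      map_smul' := fun c x => Subtype.ext (funext fun n => map_smul (T n) c (x.term n)) }
    C fun x => le_of_tendsto_of_tendsto' (BoundedSeq.tendsto_norm _) (x.tendsto_norm.const_mul C)
      fun n => hT n (x.term n)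

variable (E) in
/-- The ultraproduct of the spaces `E n` along the hyperfilter. -/
abbrev Ultraproduct : Type u := SeparationQuotient (BoundedSeq E)

namespace Ultraproduct

/-- The class of a bounded sequence in the ultraproduct. -/
noncomputable def mk (x : ∀ n, E n) {C : ℝ} (hx : ∀ n, ‖x n‖ ≤ C) : Ultraproduct E :=
  SeparationQuotient.mk (⟨x, C, hx⟩ : boundedSequences E)

theorem exists_mk_eq (x : Ultraproduct E) : ∃ (y : ∀ n, E n) (C : ℝ) (hy : ∀ n, ‖y n‖ ≤ C),
    mk y hy = x := by
  obtain ⟨⟨y, C, hy⟩, rfl⟩ := SeparationQuotient.surjective_mk x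
  exact ⟨y, C, hy, rfl⟩

theorem tendsto_norm_mk (x : ∀ n, E n) {C : ℝ} (hx : ∀ n, ‖x n‖ ≤ C) :
    Tendsto (fun n => ‖x n‖) (hyperfilter ℕ : Filter ℕ) (𝓝 ‖mk x hx‖) :=
  BoundedSeq.tendsto_norm (⟨x, C, hx⟩ : boundedSequences E)

/-- The linear map induced on the ultraproduct by a uniformly bounded sequence of linear maps. -/
noncomputable def map (T : ∀ n, E n →ₗ[ℝ] E n) {C : ℝ} (hT : ∀ n x, ‖T n x‖ ≤ C * ‖x‖) :
    Ultraproduct E →ₗ[ℝ] Ultraproduct E :=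
  (SeparationQuotient.liftCLM ((SeparationQuotient.mkCLM ℝ (BoundedSeq E)) ∘L BoundedSeq.map T hT)
    fun _ _ h => SeparationQuotient.mk_eq_mk.2 (h.map (BoundedSeq.map T hT).continuous) :
    Ultraproduct E →L[ℝ] Ultraproduct E)

theorem map_mk (T : ∀ n, E n →ₗ[ℝ] E n) {C : ℝ} (hT : ∀ n x, ‖T n x‖ ≤ C * ‖x‖) (x : ∀ n, E n)
    {D : ℝ} (hx : ∀ n, ‖x n‖ ≤ D) {D' : ℝ} (hTx : ∀ n, ‖T n (x n)‖ ≤ D') :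
    map T hT (mk x hx) = mk (fun n => T n (x n)) hTx := rfl

theorem exists_map_mk_eq (T : ∀ n, E n →ₗ[ℝ] E n) {C : ℝ} (hT : ∀ n x, ‖T n x‖ ≤ C * ‖x‖)
    (x : ∀ n, E n) {D : ℝ} (hx : ∀ n, ‖x n‖ ≤ D) :
    ∃ (D' : ℝ) (hTx : ∀ n, ‖T n (x n)‖ ≤ D'), map T hT (mk x hx) = mk (fun n => T n (x n)) hTx :=
  ⟨_, (BoundedSeq.map T hT (⟨x, D, hx⟩ : boundedSequences E)).2.choose_spec, rfl⟩

theorem mk_sub (x y : ∀ n, E n) {C D D' : ℝ} (hx : ∀ n, ‖x n‖ ≤ C) (hy : ∀ n, ‖y n‖ ≤ D)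
    (hxy : ∀ n, ‖x n - y n‖ ≤ D') : mk x hx - mk y hy = mk (fun n => x n - y n) hxy := rfl

theorem tendsto_norm_mk_sub (x y : ∀ n, E n) {C D : ℝ} (hx : ∀ n, ‖x n‖ ≤ C)
    (hy : ∀ n, ‖y n‖ ≤ D) : Tendsto (fun n => ‖x n - y n‖) (hyperfilter ℕ : Filter ℕ)
      (𝓝 ‖mk x hx - mk y hy‖) := by
  have hxy : ∀ n, ‖x n - y n‖ ≤ C + D := fun n => norm_sub_le_of_le (hx n) (hy n)
  rw [mk_sub x y hx hy hxy]
  exact tendsto_norm_mk _ hxy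

/-- The defects disappear in the limit, even though the exponents vary with `n`. -/
theorem isLpProj_map {q : ℕ → ℝ≥0∞} {q₀ : ℝ≥0∞} (hq : ∀ n, 1 ≤ q n) (hq₀ : 1 ≤ q₀)
    (hlim : Tendsto q (hyperfilter ℕ : Filter ℕ) (𝓝 q₀)) {ε : ℕ → ℝ}
    (hε : Tendsto ε (hyperfilter ℕ : Filter ℕ) (𝓝 0))
    (T : ∀ n, E n →ₗ[ℝ] E n) {C : ℝ} (hT : ∀ n x, ‖T n x‖ ≤ C * ‖x‖)
    (hproj : ∀ n, IsProjection (T n)) (h : ∀ n, IsAlmostLp (q n) (T n) (ε n)) :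
    IsLpProj q₀ (map T hT) where
  idem x := by
    obtain ⟨y, D, hy, rfl⟩ := exists_mk_eq x
    obtain ⟨D', hTy, e1⟩ := exists_map_mk_eq T hT y hy
    rw [e1, map_mk T hT _ hTy (D' := D') (fun n => by rw [hproj n]; exact hTy n)]
    congr 1
    funext n
    exact hproj n _
  norm_eq x := by
    obtain ⟨y, D, hy, rfl⟩ := exists_mk_eq x
    obtain ⟨D', hTy, e1⟩ := exists_map_mk_eq T hT y hy
    rw [e1]
    have h1 := tendsto_lpPairNorm hq hq₀ (fun n => norm_nonneg (T n (y n)))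
      (fun n => norm_nonneg (y n - T n (y n))) hlim (tendsto_norm_mk _ hTy)
      (tendsto_norm_mk_sub y _ hy hTy)
    have h2 := ((tendsto_const_nhds (x := (1 : ℝ))).sub hε).mul (tendsto_norm_mk y hy)
    have h3 := ((tendsto_const_nhds (x := (1 : ℝ))).add hε).mul (tendsto_norm_mk y hy)
    rw [sub_zero, one_mul] at h2
    rw [add_zero, one_mul] at h3
    exact tendsto_nhds_unique h1
      (tendsto_of_tendsto_of_tendsto_of_le_of_le h2 h3 (fun n => (h n _).1) fun n => (h n _).2)

end Ultraproduct

theorem exists_riesz_vector {F : Type*} [NormedAddCommGroup F] [NormedSpace ℝ F]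
    (V : Submodule ℝ F) [FiniteDimensional ℝ V] (hV : V ≠ ⊤) :
    ∃ v : F, ‖v‖ = 1 ∧ ∀ w ∈ V, ∀ c : ℝ, |c| ≤ 2 * ‖w + c • v‖ := by
  obtain ⟨x, hx, h⟩ := riesz_lemma V.closed_of_finiteDimensional
    (by simpa using (SetLike.lt_iff_le_and_exists.1 hV.lt_top).2) (r := 1 / 2) (by norm_num)
  have hx0 : x ≠ 0 := fun h0 => hx (h0 ▸ V.zero_mem)
  have hn : 0 < ‖x‖ := norm_pos_iff.2 hx0
  refine ⟨‖x‖⁻¹ • x, norm_smul_inv_norm hx0, fun w hw c => ?_⟩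
  rcases eq_or_ne c 0 with rfl | hc
  · simp
  have h1 := h (-((‖x‖ / c) • w)) (V.neg_mem (V.smul_mem _ hw))
  have h2 : w + c • ‖x‖⁻¹ • x = (c / ‖x‖) • (x - -((‖x‖ / c) • w)) := by
    rw [sub_neg_eq_add, smul_add, smul_smul, smul_smul, div_mul_div_cancel₀ hn.ne', div_self hc,
      one_smul, add_comm, div_eq_mul_inv]
  rw [h2, norm_smul, norm_div, norm_norm, Real.norm_eq_abs]
  calc |c| = 2 * (|c| / ‖x‖ * (1 / 2 * ‖x‖)) := by field_simp
    _ ≤ _ := by gcongr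

theorem span_ne_top_of_card_le {F : Type*} [NormedAddCommGroup F] [NormedSpace ℝ F]
    (hF : 2 < Module.rank ℝ F) (s : Finset F) (hs : s.card ≤ 2) :
    Submodule.span ℝ (s : Set F) ≠ ⊤ := by
  intro h
  have h1 := rank_span_finset_le (R := ℝ) s
  rw [h, rank_top] at h1
  exact absurd (hF.trans_le (h1.trans (by exact_mod_cast hs))) (lt_irrefl _)

/-- Quantitative independence with a constant independent of the space; independence alone could be
lost in the ultraproduct. -/
theorem exists_three_vectors {F : Type*} [NormedAddCommGroup F] [NormedSpace ℝ F]
    (hF : 2 < Module.rank ℝ F) : ∃ u v w : F, ‖u‖ = 1 ∧ ‖v‖ = 1 ∧ ‖w‖ = 1 ∧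
      ∀ a b c : ℝ, |b| ≤ 2 * ‖a • u + b • v‖ ∧ |c| ≤ 2 * ‖a • u + b • v + c • w‖ := by
  classical
  obtain ⟨u, hu, -⟩ := exists_riesz_vector (Submodule.span ℝ ((∅ : Finset F) : Set F))
    (span_ne_top_of_card_le hF _ (by simp))
  obtain ⟨v, hv, hv'⟩ := exists_riesz_vector (Submodule.span ℝ (({u} : Finset F) : Set F))
    (span_ne_top_of_card_le hF _ (by simp))
  obtain ⟨w, hw, hw'⟩ := exists_riesz_vector (Submodule.span ℝ (({u, v} : Finset F) : Set F))
    (span_ne_top_of_card_le hF _ Finset.card_le_two)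
  refine ⟨u, v, w, hu, hv, hw, fun a b c => ⟨hv' _ ?_ _, hw' _ ?_ _⟩⟩
  · exact Submodule.smul_mem _ _ (Submodule.subset_span (by simp))
  · exact Submodule.add_mem _ (Submodule.smul_mem _ _ (Submodule.subset_span (by simp)))
      (Submodule.smul_mem _ _ (Submodule.subset_span (by simp)))

theorem Ultraproduct.two_lt_rank (hE : ∀ n, 2 < Module.rank ℝ (E n)) :
    2 < Module.rank ℝ (Ultraproduct E) := by
  choose u v w hu hv hw h using fun n => exists_three_vectors (hE n)
  have hli : LinearIndependent ℝ ![mk u (fun n => (hu n).le), mk v (fun n => (hv n).le),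
      mk w (fun n => (hw n).le)] := by
    rw [Fintype.linearIndependent_iff]
    intro g hg
    simp only [Fin.sum_univ_three, Matrix.cons_val] at hg
    have hx : ∀ (a b c : ℝ) (n : ℕ), ‖a • u n + b • v n + c • w n‖ ≤ |a| + |b| + |c| := by
      intro a b c n
      refine norm_add₃_le.trans ?_
      simp [norm_smul, hu, hv, hw]
    have hlim : ∀ a b c : ℝ, Tendsto (fun n => ‖a • u n + b • v n + c • w n‖)
        (hyperfilter ℕ : Filter ℕ) (𝓝 ‖a • mk u (fun n => (hu n).le) +
          b • mk v (fun n => (hv n).le) + c • mk w (fun n => (hw n).le)‖) :=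
      fun a b c => tendsto_norm_mk _ (hx a b c)
    have h2 : g 2 = 0 := by
      have h1 := ge_of_tendsto' ((hlim (g 0) (g 1) (g 2)).const_mul 2)
        fun n => (h n (g 0) (g 1) (g 2)).2
      rw [hg, norm_zero, mul_zero] at h1
      exact abs_nonpos_iff.1 h1
    rw [h2, zero_smul, add_zero] at hg
    have h1 : g 1 = 0 := by
      have h1 := ge_of_tendsto' ((hlim (g 0) (g 1) 0).const_mul 2) (b := |g 1|)
        fun n => by simpa using (h n (g 0) (g 1) 0).1
      rw [zero_smul, add_zero, hg, norm_zero, mul_zero] at h1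
      exact abs_nonpos_iff.1 h1
    rw [h1, zero_smul, add_zero] at hg
    have h0 : g 0 = 0 := by
      have h3 := hlim (g 0) 0 0
      simp only [zero_smul, add_zero, hg, norm_zero, norm_smul, hu, mul_one] at h3
      exact norm_eq_zero.1 (tendsto_nhds_unique tendsto_const_nhds h3)
    intro i
    fin_cases i
    exacts [h0, h1, h2]
  have := hli.cardinal_lift_le_rank
  refine lt_of_lt_of_le ?_ (by simpa using this : (3 : Cardinal) ≤ _)
  exact_mod_cast (by norm_num : 2 < 3)

end Ultraproduct

/-! ### Almost `L^p`-projections -/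

section Almost

theorem IsAlmostLp.mono {E : Type*} [NormedAddCommGroup E] [NormedSpace ℝ E] {p : ℝ≥0∞}
    {P : E →ₗ[ℝ] E} {ε δ : ℝ} (h : IsAlmostLp p P ε) (hεδ : ε ≤ δ) : IsAlmostLp p P δ := fun x =>
  ⟨(mul_le_mul_of_nonneg_right (by linarith) (norm_nonneg x)).trans (h x).1,
    (h x).2.trans (mul_le_mul_of_nonneg_right (by linarith) (norm_nonneg x))⟩

theorem IsAlmostLp.norm_apply_le {E : Type*} [NormedAddCommGroup E] [NormedSpace ℝ E] {p : ℝ≥0∞}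
    (hp : 1 ≤ p) {P : E →ₗ[ℝ] E} {ε : ℝ} (h : IsAlmostLp p P ε) (hε : ε ≤ 1) (x : E) :
    ‖P x‖ ≤ 2 * ‖x‖ :=
  ((le_max_left _ _).trans (max_le_lpPairNorm hp (norm_nonneg _) (norm_nonneg _))).trans
    ((h x).2.trans (mul_le_mul_of_nonneg_right (by linarith) (norm_nonneg x)))

theorem IsProjection.compl {E : Type*} [NormedAddCommGroup E] [NormedSpace ℝ E]
    {P : E →ₗ[ℝ] E} (hP : IsProjection P) : IsProjection (LinearMap.id - P) := fun x => by
  have := hP x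
  simp [this]

/-- Applied to a projection and its complement, this yields unit vectors that carry nontriviality to
the ultraproduct. The value `0` when `P = 0` allows a choice for every index. -/
theorem IsProjection.exists_fixed_vector {E : Type*} [NormedAddCommGroup E] [NormedSpace ℝ E]
    {P : E →ₗ[ℝ] E} (hP : IsProjection P) :
    ∃ u : E, ‖u‖ ≤ 1 ∧ P u = u ∧ (P ≠ 0 → ‖u‖ = 1) := by
  by_cases h : P = 0
  · exact ⟨0, by simp, by simp, fun h' => absurd h h'⟩
  obtain ⟨x, hx⟩ := DFunLike.ne_iff.1 h
  have h1 : ‖‖P x‖⁻¹ • P x‖ = 1 := norm_smul_inv_norm hx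
  exact ⟨‖P x‖⁻¹ • P x, h1.le, by rw [map_smul, hP], fun _ => h1⟩

theorem tendsto_exponentDist {ι : Type*} {l : Filter ι} {p : ℝ≥0∞} {q : ι → ℝ≥0∞}
    (h : Tendsto q l (𝓝 p)) : Tendsto (fun i => exponentDist p (q i)) l (𝓝 0) := by
  unfold exponentDist
  by_cases hp : p = ∞
  · subst hp
    simpa using h.inv
  · have h1 := (ENNReal.Tendsto.sub (tendsto_const_nhds (x := p)) h (Or.inl hp)).add
      (ENNReal.Tendsto.sub h (tendsto_const_nhds (x := p)) (Or.inl hp))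
    simpa [hp] using h1

theorem eq_of_exponentDist_eq_zero {p q : ℝ≥0∞} (h : exponentDist p q = 0) : p = q := by
  unfold exponentDist at h
  split_ifs at h with hp
  · rw [hp, ENNReal.inv_eq_zero.1 h]
  · rw [add_eq_zero, tsub_eq_zero_iff_le, tsub_eq_zero_iff_le] at h
    exact le_antisymm h.1 h.2

/-- A normed space of dimension greater than two with an almost `L^p`-projection `P` and an almost
`L^q`-projection `Q`. -/
structure AlmostLpPair (p : ℝ≥0∞) (ε : ℝ) where
  carrier : Type u
  [normed : NormedAddCommGroup carrier]
  [space : NormedSpace ℝ carrier]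
  rank : 2 < Module.rank ℝ carrier
  q : ℝ≥0∞
  one_le : 1 ≤ q
  P : carrier →ₗ[ℝ] carrier
  Q : carrier →ₗ[ℝ] carrier
  isProjection_P : IsProjection P
  isProjection_Q : IsProjection Q
  isAlmostLp_P : IsAlmostLp p P ε
  isAlmostLp_Q : IsAlmostLp q Q ε

attribute [instance] AlmostLpPair.normed AlmostLpPair.space

namespace AlmostLpPair

/-- Weakening of the defect. -/
def mono {p : ℝ≥0∞} {ε δ : ℝ} (F : AlmostLpPair.{u} p ε) (h : ε ≤ δ) : AlmostLpPair.{u} p δ :=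
  { F with
    isAlmostLp_P := F.isAlmostLp_P.mono h
    isAlmostLp_Q := F.isAlmostLp_Q.mono h }

/-- `P` and `Q` commute up to `η`, and if both are nontrivial the exponents differ by at
most `η`. -/
def HasDefect {p : ℝ≥0∞} {ε : ℝ} (F : AlmostLpPair.{u} p ε) (η : ℝ≥0∞) : Prop :=
  (∀ x, ‖F.P (F.Q x) - F.Q (F.P x)‖ₑ ≤ η * ‖x‖ₑ) ∧
    (IsNontrivialProjection F.P → IsNontrivialProjection F.Q → exponentDist p F.q ≤ η)

/-- One vector of the unit ball decides the commutator bound, so a single bounded sequence tests it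
in all the spaces at once. -/
theorem exists_commutator_witness {p : ℝ≥0∞} {ε : ℝ} (F : AlmostLpPair.{u} p ε) (η : ℝ≥0∞) :
    ∃ x : F.carrier, ‖x‖ ≤ 1 ∧ (‖F.P (F.Q x) - F.Q (F.P x)‖ₑ ≤ η →
      ∀ y, ‖F.P (F.Q y) - F.Q (F.P y)‖ₑ ≤ η * ‖y‖ₑ) := by
  by_cases h : ∀ y, ‖F.P (F.Q y) - F.Q (F.P y)‖ₑ ≤ η * ‖y‖ₑ
  · exact ⟨0, by simp, fun _ => h⟩
  push Not at h
  obtain ⟨y, hy⟩ := h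
  have hy0 : y ≠ 0 := by
    rintro rfl
    simp at hy
  have hn : ‖y‖ₑ ≠ 0 := by simpa using hy0
  refine ⟨‖y‖⁻¹ • y, (norm_smul_inv_norm hy0).le, fun h => absurd h (not_le.2 ?_)⟩
  have e : F.P (F.Q (‖y‖⁻¹ • y)) - F.Q (F.P (‖y‖⁻¹ • y)) =
      ‖y‖⁻¹ • (F.P (F.Q y) - F.Q (F.P y)) := by
    simp only [map_smul, smul_sub]
  rw [e, enorm_smul, enorm_inv (norm_ne_zero_iff.2 hy0), enorm_norm, mul_comm, ← div_eq_mul_inv,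
    ENNReal.lt_div_iff_mul_lt (Or.inl hn) (Or.inl (by simp))]
  exact hy

theorem eventually_hasDefect {p : ℝ≥0∞} (hp : 1 ≤ p) (hp2 : p ≠ 2) {ε : ℕ → ℝ}
    (hε1 : ∀ n, ε n ≤ 1) (hε : Tendsto ε atTop (𝓝 0)) (F : ∀ n, AlmostLpPair.{u} p (ε n))
    {η : ℝ≥0∞} (hη : 0 < η) : ∀ᶠ n in (hyperfilter ℕ : Filter ℕ), (F n).HasDefect η := by
  have hε' : Tendsto ε (hyperfilter ℕ : Filter ℕ) (𝓝 0) :=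
    hε.mono_left (Nat.hyperfilter_le_atTop)
  obtain ⟨q₀, -, hq₀⟩ := isCompact_univ.ultrafilter_le_nhds
    ((hyperfilter ℕ).map fun n => (F n).q) (by simp)
  replace hq₀ : Tendsto (fun n => (F n).q) (hyperfilter ℕ : Filter ℕ) (𝓝 q₀) := hq₀
  have hq₀1 : 1 ≤ q₀ := ge_of_tendsto' hq₀ fun n => (F n).one_le
  have bP : ∀ n x, ‖(F n).P x‖ ≤ 2 * ‖x‖ := fun n => (F n).isAlmostLp_P.norm_apply_le hp (hε1 n)
  have bQ : ∀ n x, ‖(F n).Q x‖ ≤ 2 * ‖x‖ :=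
    fun n => (F n).isAlmostLp_Q.norm_apply_le (F n).one_le (hε1 n)
  have hP := Ultraproduct.isLpProj_map (fun _ => hp) hp tendsto_const_nhds hε' _ bP
    (fun n => (F n).isProjection_P) fun n => (F n).isAlmostLp_P
  have hQ := Ultraproduct.isLpProj_map (fun n => (F n).one_le) hq₀1 hq₀ hε' _ bQ
    (fun n => (F n).isProjection_Q) fun n => (F n).isAlmostLp_Q
  have hrank := Ultraproduct.two_lt_rank fun n => (F n).rank
  refine Filter.Eventually.and ?_ ?_
  · choose x hx hxF using fun n => (F n).exists_commutator_witness η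
    obtain ⟨_, b1, e1⟩ := Ultraproduct.exists_map_mk_eq _ bP x hx
    obtain ⟨_, b2, e2⟩ := Ultraproduct.exists_map_mk_eq _ bQ _ b1
    obtain ⟨_, b3, e3⟩ := Ultraproduct.exists_map_mk_eq _ bQ x hx
    obtain ⟨_, b4, e4⟩ := Ultraproduct.exists_map_mk_eq _ bP _ b3
    have hlim := Ultraproduct.tendsto_norm_mk_sub _ _ b4 b2
    rw [← e4, ← e2, ← e3, ← e1, hP.commute hrank hp hq₀1 (fun h => hp2 h.1) hQ, sub_self,
      norm_zero] at hlim
    have hlim' := ENNReal.tendsto_ofReal hlim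
    rw [ENNReal.ofReal_zero] at hlim'
    filter_upwards [hlim'.eventually_le_const hη] with n hn
    rw [ofReal_norm] at hn
    exact hxF n hn
  -- Along an ultrafilter either almost all pairs are nontrivial, or almost none are and the claim
  -- is vacuous.
  · by_cases hnt : ∀ᶠ n in (hyperfilter ℕ : Filter ℕ),
      IsNontrivialProjection (F n).P ∧ IsNontrivialProjection (F n).Q
    swap
    · filter_upwards [Ultrafilter.eventually_not.2 hnt] with n hn h1 h2
      exact absurd ⟨h1, h2⟩ hn
    have nontrivial_map : ∀ (T : ∀ n, (F n).carrier →ₗ[ℝ] (F n).carrier)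
        (bT : ∀ n x, ‖T n x‖ ≤ 2 * ‖x‖), (∀ n, IsProjection (T n)) →
        (∀ᶠ n in (hyperfilter ℕ : Filter ℕ), IsNontrivialProjection (T n)) →
        IsNontrivialProjection (Ultraproduct.map T bT) := by
      intro T bT hT hTnt
      choose u hu hu1 hu2 using fun n => (hT n).exists_fixed_vector
      choose v hv hv1 hv2 using fun n => (hT n).compl.exists_fixed_vector
      have hmk : ∀ (w : ∀ n, (F n).carrier) (hw : ∀ n, ‖w n‖ ≤ 1),
          (∀ᶠ n in (hyperfilter ℕ : Filter ℕ), ‖w n‖ = 1) → Ultraproduct.mk w hw ≠ 0 := by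
        intro w hw h1 h0
        have h2 := (Ultraproduct.tendsto_norm_mk w hw).congr' h1
        rw [h0, norm_zero] at h2
        exact zero_ne_one (tendsto_nhds_unique h2 tendsto_const_nhds)
      refine ⟨fun h => ?_, fun h => ?_⟩
      · refine hmk u hu (hTnt.mono fun n hn => hu2 n hn.1) ?_
        have e := Ultraproduct.map_mk T bT u hu (D' := 1) (fun n => by rw [hu1]; exact hu n)
        simp only [hu1] at e
        rw [← e, h, LinearMap.zero_apply]
      · refine hmk v hv (hTnt.mono fun n hn => hv2 n fun h => hn.2 (sub_eq_zero.1 h).symm) ?_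
        have hv3 : ∀ n, T n (v n) = 0 := fun n => by simpa using hv1 n
        have e := Ultraproduct.map_mk T bT v hv (D' := 1) (fun n => by rw [hv3]; simp)
        simp only [hv3] at e
        rw [h, LinearMap.id_apply] at e
        rw [e]
        rfl
    have hpq := hP.exponent_eq hrank hp hq₀1 hQ
      (nontrivial_map _ bP (fun n => (F n).isProjection_P) (hnt.mono fun _ h => h.1))
      (nontrivial_map _ bQ (fun n => (F n).isProjection_Q) (hnt.mono fun _ h => h.2))
    rw [← hpq] at hq₀
    filter_upwards [(tendsto_exponentDist hq₀).eventually_le_const hη] with n hn _ _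
    exact hn

theorem exists_forall_hasDefect {p : ℝ≥0∞} (hp : 1 ≤ p) (hp2 : p ≠ 2) {η : ℝ≥0∞} (hη : 0 < η) :
    ∃ ε : ℝ, 0 < ε ∧ ∀ F : AlmostLpPair.{u} p ε, F.HasDefect η := by
  by_contra! h
  choose F hF using fun n : ℕ => h (1 / ((n : ℝ) + 1)) (by positivity)
  have hev := eventually_hasDefect hp hp2
    (fun n => (div_le_one (by positivity)).2 (by linarith [n.cast_nonneg (α := ℝ)]))
    tendsto_one_div_add_atTop_nhds_zero_nat F hη
  obtain ⟨n, hn⟩ := hev.exists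
  exact hF n hn

/-- The least simultaneous bound for the commutator and for the distance of the exponents. -/
noncomputable def defectBound (p : ℝ≥0∞) (ε : ℝ) : ℝ≥0∞ :=
  sInf {η | ∀ F : AlmostLpPair.{u} p ε, F.HasDefect η}

/-- The infimum is itself admissible because both conditions are non-strict lower bounds on `η`. -/
theorem hasDefect_defectBound {p : ℝ≥0∞} {ε : ℝ} (F : AlmostLpPair.{u} p ε) :
    F.HasDefect (defectBound.{u} p ε) := by
  refine ⟨fun x => ?_, fun h1 h2 => le_sInf fun η hη => (hη F).2 h1 h2⟩
  rcases eq_or_ne x 0 with rfl | hx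
  · simp
  have hn : ‖x‖ₑ ≠ 0 := by simpa using hx
  rw [← ENNReal.div_le_iff hn (by simp)]
  refine le_sInf fun η hη => ?_
  rw [ENNReal.div_le_iff hn (by simp)]
  exact (hη F).1 x

theorem tendsto_defectBound {p : ℝ≥0∞} (hp : 1 ≤ p) (hp2 : p ≠ 2) :
    Tendsto (defectBound.{u} p) (𝓝[>] 0) (𝓝 0) := by
  refine ENNReal.tendsto_nhds_zero.2 fun η hη => ?_
  obtain ⟨ε, hε, h⟩ := exists_forall_hasDefect.{u} hp hp2 hη
  filter_upwards [Ioo_mem_nhdsGT hε] with δ hδ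
  exact sInf_le fun F => h (F.mono hδ.2.le)

end AlmostLpPair

end Almost

/-! ### Interpretations of the symbol `f^p` -/

section PowerSymbol

theorem lpPow_zero {p : ℝ≥0∞} (hp : 1 ≤ p) : lpPow p 0 = 0 := by
  unfold lpPow
  split_ifs with h
  · rfl
  · exact Real.zero_rpow (by linarith [one_le_toReal hp h])

theorem lpPow_le_lpPow {p : ℝ≥0∞} {s t : ℝ} (hs : 0 ≤ s) (hst : s ≤ t) :
    lpPow p s ≤ lpPow p t := by
  unfold lpPow
  split_ifs
  · exact hst
  · exact Real.rpow_le_rpow hs hst ENNReal.toReal_nonneg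

theorem continuous_lpPow (p : ℝ≥0∞) : Continuous (lpPow p) := by
  unfold lpPow
  split_ifs
  · exact continuous_id
  · exact Real.continuous_rpow_const ENNReal.toReal_nonneg

theorem IsPowerSymbol.eq_lpPow {E : Type*} [NormedAddCommGroup E] {p : ℝ≥0∞} {f : E → ℝ}
    (hp : 1 ≤ p) (h : IsPowerSymbol p f) (x : E) :
    f x = lpPow p ‖x‖ := by
  rcases eq_or_ne x 0 with rfl | hx
  -- At the origin `sandwich` is vacuous, since `‖x‖ ≤ s` always holds; the bound on the ball of
  -- radius `0` determines the value.
  · have := h.bound 0 0 (by simp)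
    rw [Nat.cast_zero, lpPow_zero hp] at this
    rw [norm_zero, lpPow_zero hp, abs_nonpos_iff.1 this]
  have hn : 0 < ‖x‖ := norm_pos_iff.2 hx
  refine le_antisymm ?_ ?_
  · refine ge_of_tendsto (((continuous_lpPow p).tendsto ‖x‖).mono_left
      (nhdsWithin_le_nhds (s := Set.Ioi ‖x‖))) ?_
    filter_upwards [self_mem_nhdsWithin] with t ht
    obtain ⟨r, hr1, hr2⟩ := exists_rat_btwn (Set.mem_Ioi.1 ht)
    have hr0 : (0 : ℝ) < r := hn.trans hr1
    rcases h.sandwich 0 r le_rfl (by exact_mod_cast hr0) x hr1.le with h1 | h1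
    · rw [Rat.cast_zero] at h1
      exact absurd hn h1.not_gt
    · exact h1.2.trans (lpPow_le_lpPow hr0.le hr2.le)
  · refine le_of_tendsto (((continuous_lpPow p).tendsto ‖x‖).mono_left
      (nhdsWithin_le_nhds (s := Set.Iio ‖x‖))) ?_
    filter_upwards [Ioo_mem_nhdsLT hn] with t ht
    obtain ⟨s, hs1, hs2⟩ := exists_rat_btwn ht.2
    obtain ⟨r, hr1, -⟩ := exists_rat_btwn (lt_add_one ‖x‖)
    have hs0 : (0 : ℝ) < s := ht.1.trans hs1
    rcases h.sandwich s r (by exact_mod_cast hs0.le) (by exact_mod_cast hs2.trans hr1) x hr1.le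
      with h1 | h1
    · exact absurd hs2 h1.not_gt
    · exact (lpPow_le_lpPow ht.1.le hs1.le).trans h1.1

/-- This turns an additive error in `p`-th powers into a relative error in norms, by `(1 - ε) ^ p ≤
1 - ε` and `1 + ε ≤ (1 + ε) ^ p`. -/
theorem lpPairNorm_mem_Icc_of_lpCombine {p : ℝ≥0∞} (hp : 1 ≤ p) {a b ρ ε δ : ℝ} (ha : 0 ≤ a)
    (hb : 0 ≤ b) (hρ : 0 ≤ ρ) (hε0 : 0 ≤ ε) (hε1 : ε ≤ 1) (hδ : δ ≤ ε * lpPow p ρ)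
    (h1 : lpPow p ρ - δ ≤ lpCombine p (lpPow p a) (lpPow p b))
    (h2 : lpCombine p (lpPow p a) (lpPow p b) ≤ lpPow p ρ + δ) :
    (1 - ε) * ρ ≤ lpPairNorm p a b ∧ lpPairNorm p a b ≤ (1 + ε) * ρ := by
  by_cases h : p = ∞
  · subst h
    simp only [lpPow, lpCombine, if_true] at hδ h1 h2
    rw [lpPairNorm_top]
    constructor <;> linarith
  · have hr := one_le_toReal hp h
    simp only [lpPow, lpCombine, h, if_false] at hδ h1 h2
    rw [← lpPairNorm_rpow hp h ha hb] at h1 h2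
    have hN := lpPairNorm_nonneg p ha hb
    have hρr : 0 ≤ ρ ^ p.toReal := Real.rpow_nonneg hρ _
    have hr0 : 0 < p.toReal := by linarith
    constructor
    · rw [← Real.rpow_le_rpow_iff (mul_nonneg (by linarith) hρ) hN hr0,
        Real.mul_rpow (by linarith) hρ]
      have h3 : (1 - ε) ^ p.toReal ≤ 1 - ε := by
        simpa using Real.rpow_le_rpow_of_exponent_ge' (by linarith : 0 ≤ 1 - ε) (by linarith)
          zero_le_one hr
      have := mul_le_mul_of_nonneg_right h3 hρr
      linarith
    · rw [← Real.rpow_le_rpow_iff hN (mul_nonneg (by linarith) hρ) hr0,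
        Real.mul_rpow (by linarith) hρ]
      have h3 : 1 + ε ≤ (1 + ε) ^ p.toReal := by
        simpa using Real.rpow_le_rpow_of_exponent_le (by linarith : 1 ≤ 1 + ε) hr
      have := mul_le_mul_of_nonneg_right h3 hρr
      linarith

variable {E : Type*} [NormedAddCommGroup E] [NormedSpace ℝ E] {p : ℝ≥0∞} {f : E → ℝ}

theorem ApproxLpSentence.isAlmostLp (hp : 1 ≤ p) {P : E →ₗ[ℝ] E} {m : ℕ} {ε : ℝ}
    (hf : IsPowerSymbol p f) (h : ApproxLpSentence p f P m) (hm : 2 ≤ m) (hε0 : 0 ≤ ε)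
    (hε1 : ε ≤ 1) (hmε : 1 / (m : ℝ) ≤ ε * lpPow p (1 / 2)) : IsAlmostLp p P ε := by
  intro x
  rcases eq_or_ne x 0 with rfl | hx
  · simp [lpPairNorm_zero_right hp le_rfl]
  have hn : 0 < ‖x‖ := norm_pos_iff.2 hx
  -- By homogeneity it suffices to test vectors of norm `1/2`, which lie in the ball of radius `1 -
  -- 1/m` once `m ≥ 2`.
  have hc : 0 < 1 / 2 * ‖x‖⁻¹ := by positivity
  set c := 1 / 2 * ‖x‖⁻¹ with hc'
  have hcx : c * ‖x‖ = 1 / 2 := by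
    rw [hc']
    field_simp
  have hm' : 1 / (m : ℝ) ≤ 1 / 2 :=
    one_div_le_one_div_of_le (by norm_num) (by exact_mod_cast hm)
  have hcn : ‖c • x‖ = 1 / 2 := by rw [norm_smul, Real.norm_of_nonneg hc.le, hcx]
  have h1 := h (c • x) (by rw [hcn]; linarith)
  simp only [hf.eq_lpPow hp, map_smul, ← smul_sub, norm_smul, Real.norm_of_nonneg hc.le, hcx]
    at h1
  have h2 := lpPairNorm_mem_Icc_of_lpCombine hp (by positivity) (by positivity)
    (by norm_num : (0 : ℝ) ≤ 1 / 2) hε0 hε1 hmε h1.1 h1.2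
  rw [lpPairNorm_mul hp (norm_nonneg _) (norm_nonneg _) hc.le, ← hcx] at h2
  constructor
  · refine le_of_mul_le_mul_left ?_ hc
    linarith [h2.1]
  · refine le_of_mul_le_mul_left ?_ hc
    linarith [h2.2]

end PowerSymbol

/-! ### Deduction of the two uniform statements -/

theorem lpPow_pos (p : ℝ≥0∞) {t : ℝ} (ht : 0 < t) : 0 < lpPow p t := by
  unfold lpPow
  split_ifs
  · exact ht
  · exact Real.rpow_pos_of_pos ht _

/-- The uniform version of Behrends' theorem. -/
theorem exists_uniform_behrends (k : ℕ) {p q : ℝ≥0∞} (hp : 1 ≤ p) (hq : 1 ≤ q) (hp2 : p ≠ 2)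
    {n : ℕ} (hn : 0 < n) : ∃ m : ℕ, 0 < m ∧
      ∀ (E : Type u) [NormedAddCommGroup E] [NormedSpace ℝ E], 2 < Module.rank ℝ E →
        ∀ S : ProjectionPairStructure k p q E,
          ApproxLpSentence p S.fp S.P m → ApproxLpSentence q S.fq S.Q m →
          (∀ x : E, ‖x‖ ≤ 1 - 1 / (n : ℝ) → ‖S.P (S.Q x) - S.Q (S.P x)‖ ≤ 1 / (n : ℝ)) ∧
          (IsNontrivialProjection S.P → IsNontrivialProjection S.Q →
            (∀ x : E, ‖x‖ ≤ 1 - 1 / (n : ℝ) → |S.fp x - S.fq x| ≤ 1 / (n : ℝ)) ∧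
            exponentDist p q ≤ 1 / (n : ℝ≥0∞)) := by
  -- With `η` below the distance of distinct exponents, `exponentDist p q ≤ η` forces `p = q`, hence
  -- equality of the two symbols. This is possible because `p` and `q` are fixed before `m`.
  obtain ⟨η, hη0, hη⟩ : ∃ η : ℝ≥0∞, 0 < η ∧ η < min (1 / (n : ℝ≥0∞))
      (if p = q then 1 else exponentDist p q) := by
    refine exists_between (lt_min (by simp) ?_)
    split_ifs with h
    · exact zero_lt_one
    · exact pos_iff_ne_zero.2 fun h0 => h (eq_of_exponentDist_eq_zero h0)
  obtain ⟨ε₀, hε₀, hF⟩ := AlmostLpPair.exists_forall_hasDefect.{u} hp hp2 hη0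
  set ε := min ε₀ 1 with hε
  have hεpos : 0 < ε := lt_min hε₀ zero_lt_one
  have hpp := mul_pos hεpos (lpPow_pos p (by norm_num : (0 : ℝ) < 1 / 2))
  have hqp := mul_pos hεpos (lpPow_pos q (by norm_num : (0 : ℝ) < 1 / 2))
  obtain ⟨M, hM⟩ := exists_nat_one_div_lt (lt_min hpp hqp)
  refine ⟨M + 2, by omega, fun E _ _ hE S hSP hSQ => ?_⟩
  have hM' : 1 / ((M + 2 : ℕ) : ℝ) ≤
      min (ε * lpPow p (1 / 2)) (ε * lpPow q (1 / 2)) := by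
    refine le_trans ?_ hM.le
    push_cast
    exact one_div_le_one_div_of_le (by positivity) (by linarith)
  have hP := hSP.isAlmostLp hp S.isPowerSymbol_fp (by omega) hεpos.le (min_le_right _ _)
    (hM'.trans (min_le_left _ _))
  have hQ := hSQ.isAlmostLp hq S.isPowerSymbol_fq (by omega) hεpos.le (min_le_right _ _)
    (hM'.trans (min_le_right _ _))
  obtain ⟨h1, h2⟩ := hF
    { carrier := E
      rank := hE
      q := q
      one_le := hq
      P := S.P
      Q := S.Q
      isProjection_P := S.isProjection_P
      isProjection_Q := S.isProjection_Q
      isAlmostLp_P := hP.mono (min_le_left _ _)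
      isAlmostLp_Q := hQ.mono (min_le_left _ _) }
  have hηn : η ≤ 1 / (n : ℝ≥0∞) := (hη.trans_le (min_le_left _ _)).le
  have hn0 : (0 : ℝ) < n := by exact_mod_cast hn
  refine ⟨fun x hx => ?_, fun hP' hQ' => ?_⟩
  · have hx1 : ‖x‖ ≤ 1 := hx.trans (by linarith [one_div_pos.2 hn0])
    have hx2 : ‖x‖ₑ ≤ 1 := by
      rw [← ofReal_norm, ← ENNReal.ofReal_one]
      exact ENNReal.ofReal_le_ofReal hx1
    have h3 := (h1 x).trans (mul_le_mul' hηn hx2)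
    have h4 : 1 / (n : ℝ≥0∞) * 1 = ENNReal.ofReal (1 / n) := by
      rw [mul_one, ENNReal.ofReal_div_of_pos hn0, ENNReal.ofReal_one, ENNReal.ofReal_natCast]
    rw [h4, ← ofReal_norm] at h3
    exact (ENNReal.ofReal_le_ofReal_iff (by positivity)).1 h3
  · have h3 := h2 hP' hQ'
    have hpq : p = q := by
      by_contra hne
      rw [if_neg hne] at hη
      exact (h3.trans_lt (hη.trans_le (min_le_right _ _))).false
    refine ⟨fun x _ => ?_, h3.trans hηn⟩
    rw [S.isPowerSymbol_fp.eq_lpPow hp, S.isPowerSymbol_fq.eq_lpPow hq, hpq, sub_self, abs_zero]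
    positivity

theorem mainTheorem5 :
    -- the uniform version of Behrends' theorem
    (∀ (k : ℕ) (p q : ℝ≥0∞), 1 ≤ p → 1 ≤ q → p ≠ 2 →
      ∀ n : ℕ, 0 < n → ∃ m : ℕ, 0 < m ∧
        ∀ (E : Type u) [NormedAddCommGroup E] [NormedSpace ℝ E],
          2 < Module.rank ℝ E →
          ∀ S : ProjectionPairStructure k p q E,
            ApproxLpSentence p S.fp S.P m → ApproxLpSentence q S.fq S.Q m →
            (∀ x : E, ‖x‖ ≤ 1 - 1 / (n : ℝ) →
              ‖S.P (S.Q x) - S.Q (S.P x)‖ ≤ 1 / (n : ℝ)) ∧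
            (IsNontrivialProjection S.P → IsNontrivialProjection S.Q →
              (∀ x : E, ‖x‖ ≤ 1 - 1 / (n : ℝ) → |S.fp x - S.fq x| ≤ 1 / (n : ℝ)) ∧
              exponentDist p q ≤ 1 / (n : ℝ≥0∞))) ∧
    -- the theorem of Cambern, Jarosz and Wodinski
    (∀ p : ℝ≥0∞, 1 ≤ p → p ≠ 2 →
      ∃ ε' : ℝ → ℝ≥0∞, Tendsto ε' (𝓝[>] 0) (𝓝 0) ∧
        ∀ ε : ℝ, 0 < ε → ∀ q : ℝ≥0∞, 1 ≤ q →
          ∀ (E : Type u) [NormedAddCommGroup E] [NormedSpace ℝ E],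
            2 < Module.rank ℝ E →
            ∀ P Q : E →ₗ[ℝ] E, IsProjection P → IsProjection Q →
              IsAlmostLp p P ε → IsAlmostLp q Q ε →
              (∀ x : E, ‖P (Q x) - Q (P x)‖ₑ ≤ ε' ε * ‖x‖ₑ) ∧
              (IsNontrivialProjection P → IsNontrivialProjection Q →
                exponentDist p q ≤ ε' ε)) := by
  refine ⟨fun k p q hp hq hp2 n hn => exists_uniform_behrends k hp hq hp2 hn, fun p hp hp2 => ?_⟩
  refine ⟨AlmostLpPair.defectBound.{u} p, AlmostLpPair.tendsto_defectBound hp hp2, ?_⟩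
  intro ε _ q hq E _ _ hE P Q hP hQ hPε hQε
  exact AlmostLpPair.hasDefect_defectBound
    { carrier := E
      rank := hE
      q := q
      one_le := hq
      P := P
      Q := Q
      isProjection_P := hP
      isProjection_Q := hQ
      isAlmostLp_P := hPε
      isAlmostLp_Q := hQε }
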